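/- **Setting.** Let $\Omega\subset\mathbb R^n$ be open and bounded, $A\subset\mathbb R^m$ compact, $a_0\in A$, $\lambda>0$. Let $f:\overline\Omega\times A\to\mathbb R^n$ be Lipschitz in $x$ (uniformly in $a$) and continuous in $a$, and let $K:\overline\Omega\times A\to\mathbb R$ and $q:\overline\Omega\to\mathbb R$ be lower semicontinuous with $0\le q_1\le q\le q_2$, $q_1=\min_{\overline\Omega}q$, and $0\le K_1\le K\le K_2$. The control $a_0$ is motionless and free: $f(x,a_0)=0$ and $K(x,a_0)=0$ for all $x\in\overline\Omega$. Put $$\overline K_1=\inf\{K(x,a): x\in\overline\Omega,\ a\in A\setminus\{a_0\}\}\ \ge 0\qquad(\inf\emptyset=+\infty).$$ An admissible control at $x$ is a measurable $a(\cdot)$ with values in $A$ whose trajectory, $y'=f(y,a)$ a.e., $y(0)=x$, stays in $\overline\Omega$ for all $t\ge0$. Its cost, for an exponentially distributed termination time of rate $\lambda$, is $$J(x,a(\cdot))=\int_0^\infty\lambda e^{-\lambda t}\Big[\int_0^tK(y(s),a(s))\,ds+q(y(t))\Big]dt ,$$ and $v(x)=\inf J(x,a(\cdot))$ over all admissible controls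 at $x$. A control is optimal if it attains $v(x)$, and $\varepsilon$-suboptimal if its cost is at most $v(x)+\varepsilon$. It is eventually motionless (e.m.) if for some $T\ge0$ it equals $a_0$ for all $t\ge T$. The motionless set is $\mathcal M=\{x\in\overline\Omega: v(x)=J(x,a_0)=q(x)\}$. We say that a control never resumes motion if, whenever it has taken the value $a_0$ on a subset of $[0,T]$ of positive measure, it equals $a_0$ at almost all times after $T$. The system is controllable if $|f|\le F_2$ and there is $F_1>0$ such that for all $x\in\overline\Omega$ and all unit vectors $w$ there is $a\in A$ with $w\cdot f(x,a)=|f(x,a)|\ge F_1$. Put $L_v=(K_2+\lambda q_2)/F_1$. **Theorem.** Let $x\in\Omega$. 1. $q_1\le v(x)\le q(x)$. 2. If $q(x)=q_1$, then $x\in\mathcal M$. 3. For every $\varepsilon>0$ there is an $\varepsilon$-suboptimal e.m. control at $x$. 4. If $\overline K_1>0$, then every optimal control at $x$ that never resumes motion is e.m. (after modification on a null set of times). Moreover, for every optimal control $a(\cdot)$ at $x$ with trajectory $y(\cdot)$, the set $\{t\ge0: a(t)\ne a_0\}$ has finite measure, and for every $T_0\ge0$ there is $T\ge T_0$ such that $y(T)\in\mathcal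 M$ and the e.m. control equal to $a$ before $T$ and to $a_0$ from $T$ on is also optimal. 5. Along every optimal trajectory $y(\cdot)$ from $x$, $t\mapsto v(y(t))$ is nonincreasing on $[0,\infty)$. If $\overline K_1>0$, then $v(y(t))<v(y(s))$ for all $0\le s<t$ such that $a(r)\neq a_0$ on a subset of $[s,t]$ of positive measure; in particular, $v(y(t))$ is strictly decreasing on $[0,T]$ if the control does not pause before $T$ (that is, $a\neq a_0$ a.e. on $[0,T]$). 6. If the system is controllable, $\overline K_1>0$, $y(\cdot)$ is an optimal trajectory from $x$ with control $a(\cdot)$, $t\ge0$, and the segment from $x$ to $y(t)$ lies in $\overline\Omega$, then $$|y(t)-x|\ \ge\ \theta(t)\,\frac{\overline K_1F_1}{K_2+\lambda q_2},$$ where $\theta(t)$ is the measure of $\{s\in[0,t]: a(s)\ne a_0\}$, so that $\theta(t)=t$ as long as the trajectory has not paused or stopped. (If $A=\{a_0\}$, so that $\overline K_1=+\infty$ and $\theta\equiv0$, the right-hand side is read as $0$.) 7. Let $D(x_1,x_2)\in[0,\infty]$ be the infimum of the lengths of admissible trajectories from $x_1$ to $x_2$ (in $\overline\Omega$) and $D=\sup_{x_1,x_2\in\overline\Omega}D(x_1,x_2)$.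 If the system is controllable, then $v(x)\le q_1+D\,L_v$. -/

import Mathlib

open MeasureTheory Set

noncomputable section

/-- Raw data of a randomly terminated, state-constrained control problem: the domain `Ω`, the
set `A` of control values with the distinguished value `a₀`, the velocity `f`, the running cost `K`,
the terminal cost `q` and the termination rate `lam`. Only the values of `f`, `K` on
`closure Ω × A` and those of `q` on `closure Ω` matter. -/
structure StoppingProblem (n m : ℕ) where
  Ω : Set (EuclideanSpace ℝ (Fin n))
  A : Set (EuclideanSpace ℝ (Fin m))
  a₀ : EuclideanSpace ℝ (Fin m)
  f : EuclideanSpace ℝ (Fin n) → EuclideanSpace ℝ (Fin m) → EuclideanSpace ℝ (Fin n)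
  K : EuclideanSpace ℝ (Fin n) → EuclideanSpace ℝ (Fin m) → ℝ
  q : EuclideanSpace ℝ (Fin n) → ℝ
  lam : ℝ

namespace StoppingProblem

variable {n m : ℕ} (P : StoppingProblem n m)

/-- Standing regularity: bounded open domain, compact control set, velocity Lipschitz in the state
(uniformly in the control value) and continuous in the control value, lower semicontinuous costs,
positive termination rate. -/
structure Regular : Prop where
  isOpen_Ω : IsOpen P.Ω
  isBounded_Ω : Bornology.IsBounded P.Ω
  isCompact_A : IsCompact P.A
  a₀_mem : P.a₀ ∈ P.A
  lipschitz_f : ∃ L : NNReal, ∀ a ∈ P.A, LipschitzOnWith L (fun x => P.f x a) (closure P.Ω)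
  continuous_f : ∀ x ∈ closure P.Ω, ContinuousOn (P.f x) P.A
  lsc_K : LowerSemicontinuousOn (fun p : _ × _ => P.K p.1 p.2) (closure P.Ω ×ˢ P.A)
  lsc_q : LowerSemicontinuousOn P.q (closure P.Ω)
  lam_pos : 0 < P.lam

/-- The terminal cost has minimum `q₁ ≥ 0` on the closed domain and is bounded above by `q₂`. -/
def TerminalCostBounds (q₁ q₂ : ℝ) : Prop :=
  IsLeast (P.q '' closure P.Ω) q₁ ∧ 0 ≤ q₁ ∧ ∀ x ∈ closure P.Ω, P.q x ≤ q₂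

/-- `0 ≤ K₁ ≤ K ≤ K₂`. -/
def RunningCostBounds (K₁ K₂ : ℝ) : Prop :=
  0 ≤ K₁ ∧ ∀ x ∈ closure P.Ω, ∀ a ∈ P.A, K₁ ≤ P.K x a ∧ P.K x a ≤ K₂

/-- Controllability: the velocity is bounded by `F₂`, and from every state one can move in every
direction with speed at least `F₁ > 0`. -/
def Controllable (F₁ F₂ : ℝ) : Prop :=
  0 < F₁ ∧ (∀ x ∈ closure P.Ω, ∀ a ∈ P.A, ‖P.f x a‖ ≤ F₂) ∧
    ∀ x ∈ closure P.Ω, ∀ w : EuclideanSpace ℝ (Fin n), ‖w‖ = 1 →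
      ∃ a ∈ P.A, inner ℝ w (P.f x a) = ‖P.f x a‖ ∧ F₁ ≤ ‖P.f x a‖

/-- The value `a₀` produces no motion and has no running cost. -/
def FreeMotionless : Prop :=
  (∀ x ∈ closure P.Ω, P.f x P.a₀ = 0) ∧ ∀ x ∈ closure P.Ω, P.K x P.a₀ = 0

/-- The infimum `K̄₁` of the running cost over the closed domain and over the control values other
than `a₀` (equal to `+∞` if there are none). -/
def movingCostInf : EReal :=
  ⨅ x ∈ closure P.Ω, ⨅ a ∈ P.A \ {P.a₀}, (P.K x a : EReal)

/-- Controls: measurable functions of time with values in `A`. -/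
def IsControl (a : ℝ → EuclideanSpace ℝ (Fin m)) : Prop :=
  Measurable a ∧ ∀ t, a t ∈ P.A

/-- `a` is an admissible control at `x` and `y` is its trajectory: `y` is a (Carathéodory) solution
of `y' = f (y, a)`, `y 0 = x`, that stays in the closed domain at all times `t ≥ 0`. -/
structure IsAdmissible (x : EuclideanSpace ℝ (Fin n)) (a : ℝ → EuclideanSpace ℝ (Fin m))
    (y : ℝ → EuclideanSpace ℝ (Fin n)) : Prop where
  isControl : P.IsControl a
  continuousOn : ContinuousOn y (Ici 0)
  mem_closure : ∀ t, 0 ≤ t → y t ∈ closure P.Ω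
  intervalIntegrable : ∀ t, 0 ≤ t → IntervalIntegrable (fun s => P.f (y s) (a s)) volume 0 t
  eq_integral : ∀ t, 0 ≤ t → y t = x + ∫ s in (0 : ℝ)..t, P.f (y s) (a s)

/-- The deterministic cost `ω(t)` of a control if termination happens at time `t`. -/
def costAt (a : ℝ → EuclideanSpace ℝ (Fin m)) (y : ℝ → EuclideanSpace ℝ (Fin n)) (t : ℝ) : ℝ :=
  (∫ s in (0 : ℝ)..t, P.K (y s) (a s)) + P.q (y t)

/-- The expected cost of a control with trajectory `y`; the termination time is exponentially
distributed with rate `lam`. -/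
def cost (a : ℝ → EuclideanSpace ℝ (Fin m)) (y : ℝ → EuclideanSpace ℝ (Fin n)) : ℝ :=
  ∫ t in Ioi (0 : ℝ), P.lam * Real.exp (-P.lam * t) * P.costAt a y t

/-- The value function. -/
def value (x : EuclideanSpace ℝ (Fin n)) : ℝ :=
  sInf {c | ∃ a y, P.IsAdmissible x a y ∧ c = P.cost a y}

/-- `a` is an optimal control at `x`, with optimal trajectory `y`. -/
def IsOptimal (x : EuclideanSpace ℝ (Fin n)) (a : ℝ → EuclideanSpace ℝ (Fin m))
    (y : ℝ → EuclideanSpace ℝ (Fin n)) : Prop :=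
  P.IsAdmissible x a y ∧ P.cost a y = P.value x

/-- The motionless set: staying put is optimal, and `v = q`. -/
def motionlessSet : Set (EuclideanSpace ℝ (Fin n)) :=
  {x ∈ closure P.Ω | P.value x = P.cost (fun _ => P.a₀) (fun _ => x) ∧ P.value x = P.q x}

/-- Eventually motionless (e.m.) controls. -/
def IsEventuallyMotionless (a : ℝ → EuclideanSpace ℝ (Fin m)) : Prop :=
  ∃ T : ℝ, 0 ≤ T ∧ ∀ t, T ≤ t → a t = P.a₀

/-- A control that never resumes motion: once `a₀` has been used for a positive amount of time,
it is used at almost all later times. -/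
def NeverResumes (a : ℝ → EuclideanSpace ℝ (Fin m)) : Prop :=
  ∀ T : ℝ, 0 < volume {s ∈ Icc 0 T | a s = P.a₀} → ∀ᵐ t, T ≤ t → a t = P.a₀

/-- The control `a`, made motionless from time `T` on. -/
def stopControl (a : ℝ → EuclideanSpace ℝ (Fin m)) (T : ℝ) : ℝ → EuclideanSpace ℝ (Fin m) :=
  fun t => if t < T then a t else P.a₀

/-- The length of a shortest allowable trajectory from `x₁` to `x₂` (`+∞` if there is none of
finite length). -/
def pathDist (x₁ x₂ : EuclideanSpace ℝ (Fin n)) : ENNReal :=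
  sInf {ℓ | ∃ a y, P.IsAdmissible x₁ a y ∧ ∃ T : ℝ, 0 ≤ T ∧ y T = x₂ ∧
    ℓ = eVariationOn y (Icc 0 T)}

/-- The diameter `D` of the closed domain for `pathDist`. -/
def pathDiam : ENNReal :=
  ⨆ x₁ ∈ closure P.Ω, ⨆ x₂ ∈ closure P.Ω, P.pathDist x₁ x₂

end StoppingProblem

end

/-!
Write `V t = v (y t)` for the value along an admissible trajectory `y` with control `a`, and
`C = K₂ + λ q₂`. After integration by parts, the expected cost is the discounted integral of the
rate `K + λ q` (`Standing.cost_eq`), so costs split at a fixed time, controls can be concatenated, and Bellman's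
principle holds in both directions (`Standing.value_le_integral_add`,
`Standing.value_eq_cost_shift`). Along an optimal trajectory it gives the identity

  `V s - V t = ∫ r in s..t, K (y, a) + λ (q y - v y)`        (`Standing.value_sub_value`),

whose integrand is nonnegative, and at least the infimum `κ` of the running cost over moving
controls wherever `a ≠ a₀`. Hence `V` is nonincreasing and drops by at least `κ` times the time
spent moving (`Standing.mul_volume_le_value_sub`). Since `V` is bounded, for `κ > 0` the total time
spent moving is finite.

For upper bounds on the drop of the value, a path is retraced with a new control and a new clock:
if a path has velocity `ρ • f (y, α)` with `ρ ≥ 0`, then the control `α`, read in the clock `∫ ρ`,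
drives the system along it in time `∫ ρ`, at a cost of at most `C` per unit of time
(`Standing.value_le_of_eq_integral_smul`). This is used twice.

* With `ρ` the indicator of `a ≠ a₀`, the pauses of an optimal control are left out, and `V` drops
  by at most `C` times the time spent moving. Compared with the identity above on all intervals,
  this forces `q = v` at almost all times when the control pauses
  (`Standing.ae_mem_motionlessSet_of_pause`). As the time spent moving is finite, such times occur
  arbitrarily late, and stopping at one of them costs nothing.
* In a controllable system, any path can be retraced at speed at least `F₁` by a control that points
  along its velocity. Such a control is chosen measurably (`exists_measurable_selection`: the
  control set is a continuous image of the Cantor set, where least elements can be taken). The value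
  therefore drops along any path by at most `C / F₁` times its length
  (`Standing.value_le_of_path`). Segments give the growth of the distance, and admissible
  trajectories to a minimizer of `q` give the bound through the diameter; for these,
  `ofReal_integral_norm_le_eVariationOn` compares the integral of the speed with the variation.
-/

/-! ### Integration and measurable selection -/

/-- Integration by parts of an exponential against the primitive of a merely integrable function. -/
theorem integral_exp_mul_primitive {k : ℝ → ℝ} {T : ℝ} (hk : IntervalIntegrable k volume 0 T)
    (c : ℝ) :
    ∫ r in (0 : ℝ)..T, c * Real.exp (c * r) * ∫ s in (0 : ℝ)..r, k s =
      Real.exp (c * T) * (∫ s in (0 : ℝ)..T, k s) - ∫ r in (0 : ℝ)..T, Real.exp (c * r) * k r := by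
  have hexp : ∀ r : ℝ, HasDerivAt (fun r => Real.exp (c * r)) (c * Real.exp (c * r)) r :=
    fun r => by simpa [mul_comm] using ((hasDerivAt_id r).const_mul c).exp
  have hac : AbsolutelyContinuousOnInterval (fun r => Real.exp (c * r)) 0 T := by
    have hcd : ContDiff ℝ 1 fun r => Real.exp (c * r) := by fun_prop
    exact hcd.contDiffOn.absolutelyContinuousOnInterval
  have h := (hk.absolutelyContinuousOnInterval_intervalIntegral
    (c := 0) (by simp)).integral_mul_deriv_eq_deriv_mul hac
  have h1 : ∫ r in (0 : ℝ)..T, deriv (fun x => ∫ v in (0 : ℝ)..x, k v) r * Real.exp (c * r) =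
      ∫ r in (0 : ℝ)..T, Real.exp (c * r) * k r := by
    refine intervalIntegral.integral_congr_ae ?_
    filter_upwards [hk.ae_hasDerivAt_integral] with r hr hmem
    rw [(hr (uIoc_subset_uIcc hmem) 0 (by simp)).deriv, mul_comm]
  rw [h1] at h
  simp only [(hexp _).deriv, intervalIntegral.integral_same, zero_mul, sub_zero] at h
  rw [mul_comm (Real.exp (c * T)), ← h]
  exact intervalIntegral.integral_congr fun r _ => mul_comm _ _

/-- A consequence of Lebesgue's differentiation theorem. -/
theorem ae_nonpos_of_forall_intervalIntegral_nonpos {g : ℝ → ℝ}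
    (hg : ∀ t, 0 ≤ t → IntervalIntegrable g volume 0 t)
    (h : ∀ s t, 0 ≤ s → s ≤ t → ∫ r in s..t, g r ≤ 0) : ∀ᵐ r, 0 < r → g r ≤ 0 := by
  have key : ∀ N : ℕ, ∀ᵐ r, r ∈ Ioo (0 : ℝ) N → g r ≤ 0 := by
    intro N
    have hN : (0 : ℝ) ≤ N := N.cast_nonneg
    filter_upwards [(hg N hN).ae_hasDerivAt_integral] with r hr hmem
    have hd := hr (by rw [uIcc_of_le hN]; exact Ioo_subset_Icc_self hmem) 0 (by simp)
    have hd' := (hasDerivWithinAt_iff_tendsto_slope' (by simp)).1 (hd.hasDerivWithinAt (s := Ioi r))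
    refine le_of_tendsto hd' ?_
    filter_upwards [self_mem_nhdsWithin] with t ht
    have ht' : r < t := ht
    rw [slope_def_field, intervalIntegral.integral_interval_sub_left
      (hg t (hmem.1.le.trans ht'.le)) (hg r hmem.1.le)]
    exact div_nonpos_of_nonpos_of_nonneg (h r t hmem.1.le ht'.le) (sub_nonneg.2 ht'.le)
  filter_upwards [ae_all_iff.2 key] with r hr h0
  obtain ⟨N, hN⟩ := exists_nat_gt r
  exact hr N ⟨h0, hN⟩

/-- Measurable selection for a closed relation with compact target. The target is a continuous image
of the Cantor set; the least point of the Cantor set over a fibre depends lower semicontinuously on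
the base point. -/
theorem exists_measurable_selection {X Y : Type*} [TopologicalSpace X] [MeasurableSpace X]
    [OpensMeasurableSpace X] [MetricSpace Y] [CompactSpace Y] [MeasurableSpace Y] [BorelSpace Y]
    {C : Set (X × Y)} (hC : IsClosed C) (hne : ∀ x, ∃ y, (x, y) ∈ C) :
    ∃ s : X → Y, Measurable s ∧ ∀ x, (x, s x) ∈ C := by
  cases isEmpty_or_nonempty X
  · exact ⟨fun x => isEmptyElim x, measurable_of_empty _, fun x => isEmptyElim x⟩
  have : Nonempty Y := ⟨(hne (Classical.arbitrary X)).choose⟩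
  obtain ⟨h₀, hc₀, hs₀⟩ := exists_nat_bool_continuous_surjective_of_compact Y
  set h : cantorSet → Y := h₀ ∘ cantorSetHomeomorphNatToBool
  have hc : Continuous h := hc₀.comp cantorSetHomeomorphNatToBool.continuous
  have hs : Function.Surjective h := hs₀.comp cantorSetHomeomorphNatToBool.surjective
  have : CompactSpace cantorSet := isCompact_iff_compactSpace.1 isCompact_cantorSet
  have hmin : ∀ x, ∃ c : cantorSet, (x, h c) ∈ C ∧ ∀ d : cantorSet, (x, h d) ∈ C → c ≤ d := by
    intro x
    have hcl : IsClosed {c : cantorSet | (x, h c) ∈ C} :=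
      hC.preimage (continuous_const.prodMk hc)
    obtain ⟨y, hy⟩ := hne x
    obtain ⟨c, rfl⟩ := hs y
    obtain ⟨c, hc1, hc2⟩ := hcl.isCompact.exists_isLeast ⟨c, hy⟩
    exact ⟨c, hc1, fun d hd => hc2 hd⟩
  choose φ hφ hφmin using hmin
  -- sublevel sets of `φ` are projections of closed sets along the compact Cantor set
  refine ⟨fun x => h (φ x), hc.measurable.comp ?_, hφ⟩
  have : Measurable fun x => (φ x : ℝ) := by
    refine measurable_of_Iic fun r => IsClosed.measurableSet ?_
    have hcl : IsClosed {p : X × cantorSet | (p.1, h p.2) ∈ C ∧ (p.2 : ℝ) ≤ r} := by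
      refine (hC.preimage (continuous_fst.prodMk (hc.comp continuous_snd))).inter ?_
      exact isClosed_le (continuous_subtype_val.comp continuous_snd) continuous_const
    convert isClosedMap_fst_of_compactSpace _ hcl
    ext x
    constructor
    · intro hx
      exact ⟨(x, φ x), ⟨hφ x, hx⟩, rfl⟩
    · rintro ⟨⟨x', c⟩, ⟨h1, h2⟩, rfl⟩
      exact (Subtype.coe_le_coe.2 (hφmin x' c h1)).trans h2
  exact this.subtype_mk (h := fun x => (φ x).2)

/-- The length of an absolutely continuous path is at least the integral of its speed: almost
everywhere, the speed is at most the derivative of the variation function, and the integral of the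
derivative of a monotone function is at most its increment. -/
theorem ofReal_integral_norm_le_eVariationOn {E : Type*} [NormedAddCommGroup E] [NormedSpace ℝ E]
    [CompleteSpace E] {y p : ℝ → E} {x : E} {T : ℝ} (hT : 0 ≤ T)
    (hp : IntervalIntegrable p volume 0 T)
    (hy : ∀ t ∈ Icc 0 T, y t = x + ∫ s in (0 : ℝ)..t, p s) :
    ENNReal.ofReal (∫ s in (0 : ℝ)..T, ‖p s‖) ≤ eVariationOn y (Icc 0 T) := by
  by_cases htop : eVariationOn y (Icc 0 T) = ⊤
  · simp [htop]
  have hbv : LocallyBoundedVariationOn y (Icc 0 T) :=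
    BoundedVariationOn.locallyBoundedVariationOn htop
  set ν := variationOnFromTo y (Icc 0 T) 0 with hν
  have h0 : (0 : ℝ) ∈ Icc 0 T := left_mem_Icc.2 hT
  have hmono : MonotoneOn ν (Icc 0 T) := variationOnFromTo.monotoneOn hbv h0
  have hmono' : MonotoneOn ν (uIcc 0 T) := by rwa [uIcc_of_le hT]
  have hνT : ν T - ν 0 = (eVariationOn y (Icc 0 T)).toReal := by
    rw [hν, variationOnFromTo.self, sub_zero, variationOnFromTo.eq_of_le _ _ hT, inter_self]
  have hle : ∫ s in (0 : ℝ)..T, deriv ν s ≤ ν T - ν 0 := by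
    have h := hmono'.intervalIntegral_deriv_mem_uIcc
    rw [uIcc_of_le (by rw [hνT]; exact ENNReal.toReal_nonneg)] at h
    exact h.2
  have hae : ∀ᵐ s ∂volume.restrict (Icc 0 T), ‖p s‖ ≤ deriv ν s := by
    rw [ae_restrict_iff' measurableSet_Icc]
    filter_upwards [hp.ae_hasDerivAt_integral, hmono.ae_differentiableWithinAt_of_mem,
      compl_mem_ae_iff.2 (measure_singleton (μ := volume) (0 : ℝ)),
      compl_mem_ae_iff.2 (measure_singleton (μ := volume) T)] with s h1 h2 h3 h4 hs
    have hsT : s < T := lt_of_le_of_ne hs.2 h4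
    have hnhds : Icc 0 T ∈ nhds s := Icc_mem_nhds (lt_of_le_of_ne hs.1 (Ne.symm h3)) hsT
    have hyd : HasDerivAt y (p s) s := by
      have := (h1 (by rwa [uIcc_of_le hT]) 0 (by simp)).const_add x
      refine this.congr_of_eventuallyEq ?_
      filter_upwards [hnhds] with t ht using hy t ht
    have hνd : HasDerivAt ν (deriv ν s) s := ((h2 hs).differentiableAt hnhds).hasDerivAt
    have l1 := (hasDerivWithinAt_iff_tendsto_slope' (by simp)).1 (hyd.hasDerivWithinAt (s := Ioi s))
    have l2 := (hasDerivWithinAt_iff_tendsto_slope' (by simp)).1 (hνd.hasDerivWithinAt (s := Ioi s))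
    refine le_of_tendsto_of_tendsto l1.norm l2 ?_
    filter_upwards [Ioo_mem_nhdsGT hsT] with t ht
    have htm : t ∈ Icc 0 T := ⟨hs.1.trans ht.1.le, ht.2.le⟩
    have hd : ‖y t - y s‖ ≤ ν t - ν s := by
      have hadd := variationOnFromTo.add hbv h0 hs htm
      rw [show ν t - ν s = variationOnFromTo y (Icc 0 T) s t by simp only [hν]; linarith,
        variationOnFromTo.eq_of_le _ _ ht.1.le, ← dist_eq_norm, dist_edist]
      refine ENNReal.toReal_mono (hbv s t hs htm) ?_
      exact eVariationOn.edist_le y ⟨htm, ht.1.le, le_rfl⟩ ⟨hs, le_rfl, ht.1.le⟩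
    have hts : 0 < t - s := sub_pos.2 ht.1
    rw [slope_def_module, slope_def_field, norm_smul, norm_inv, Real.norm_of_nonneg hts.le,
      div_eq_inv_mul]
    gcongr
  have hfin : ∫ s in (0 : ℝ)..T, ‖p s‖ ≤ ∫ s in (0 : ℝ)..T, deriv ν s :=
    intervalIntegral.integral_mono_ae_restrict hT hp.norm hmono'.intervalIntegrable_deriv hae
  rw [← ENNReal.ofReal_toReal htop, ← hνT]
  exact ENNReal.ofReal_le_ofReal (hfin.trans hle)

/-- The generalized inverse `τ` of the clock `σ t = ∫ s in 0..t, ρ s`, that is, the first time at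
which `σ` reaches a given level, pushes Lebesgue measure forward to the measure with density `ρ`.
The reason is the Galois connection `τ u ≤ t ↔ u ≤ σ t`. -/
theorem exists_time_change {ρ : ℝ → ℝ} (hρ0 : ∀ t, 0 ≤ ρ t)
    (hρi : ∀ t, 0 ≤ t → IntervalIntegrable ρ volume 0 t)
    (hinf : ∀ u : ℝ, ∃ t, 0 ≤ t ∧ u ≤ ∫ s in (0 : ℝ)..t, ρ s) :
    ∃ τ : ℝ → ℝ, Measurable τ ∧ (∀ u, 0 ≤ τ u) ∧
      (∀ u, 0 ≤ u → ∫ s in (0 : ℝ)..τ u, ρ s = u) ∧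
      ∀ t, 0 ≤ t → Measure.map τ (volume.restrict (Ioc 0 (∫ s in (0 : ℝ)..t, ρ s))) =
        (volume.restrict (Ioc 0 t)).withDensity fun r => ENNReal.ofReal (ρ r) := by
  set σ : ℝ → ℝ := fun t => ∫ s in (0 : ℝ)..t, ρ s with hσ
  have hmono : ∀ s t, 0 ≤ s → s ≤ t → σ s ≤ σ t := fun s t hs hst =>
    intervalIntegral.integral_mono_interval le_rfl hs hst (ae_of_all _ hρ0) (hρi t (hs.trans hst))
  have hσ0 : σ 0 = 0 := by simp [hσ]
  have hcont : ContinuousOn σ (Ici 0) := by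
    intro t ht
    have ht' : (0 : ℝ) ≤ t + 1 := by have : (0 : ℝ) ≤ t := ht; linarith
    have := intervalIntegral.continuousOn_primitive_interval
      ((intervalIntegrable_iff_integrableOn_Icc_of_le ht').1 (hρi (t + 1) ht') |> fun h => by
        rwa [← uIcc_of_le ht'] at h)
    rw [uIcc_of_le ht'] at this
    refine (this t ⟨ht, by linarith⟩).mono_of_mem_nhdsWithin ?_
    filter_upwards [self_mem_nhdsWithin, nhdsWithin_le_nhds (Iic_mem_nhds (lt_add_one t))]
      with s hs hs' using ⟨hs, hs'⟩
  have hex : ∀ u : ℝ, ∃ τ : ℝ, 0 ≤ τ ∧ u ≤ σ τ ∧ ∀ t, 0 ≤ t → u ≤ σ t → τ ≤ t := by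
    intro u
    have hcl : IsClosed (Ici (0 : ℝ) ∩ σ ⁻¹' Ici u) :=
      hcont.preimage_isClosed_of_isClosed isClosed_Ici isClosed_Ici
    obtain ⟨t, ht0, htu⟩ := hinf u
    have hmem := hcl.csInf_mem ⟨t, ht0, htu⟩ ⟨0, fun s hs => hs.1⟩
    exact ⟨_, hmem.1, hmem.2, fun s hs hus => csInf_le ⟨0, fun s hs => hs.1⟩ ⟨hs, hus⟩⟩
  choose τ hτ0 hτu hτmin using hex
  have galois : ∀ u t, 0 ≤ t → (τ u ≤ t ↔ u ≤ σ t) := fun u t ht =>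
    ⟨fun h => (hτu u).trans (hmono _ _ (hτ0 u) h), hτmin u t ht⟩
  have hτmono : Monotone τ := fun u v huv => hτmin u _ (hτ0 v) (huv.trans (hτu v))
  refine ⟨τ, hτmono.measurable, hτ0, fun u hu => le_antisymm ?_ (hτu u), fun t ht => ?_⟩
  · by_contra! hlt
    have hlt' : u < σ (τ u) := hlt
    obtain ⟨s, hs, hsu⟩ := intermediate_value_Icc (hτ0 u) (hcont.mono Icc_subset_Ici_self)
      ⟨hσ0.trans_le hu, hlt'.le⟩
    have := hτmin u s hs.1 hsu.ge
    rw [le_antisymm this hs.2, hsu] at hlt'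
    exact lt_irrefl _ hlt'
  · refine Measure.ext_of_Iic _ _ fun c => ?_
    rw [Measure.map_apply hτmono.measurable measurableSet_Iic,
      withDensity_apply _ measurableSet_Iic,
      Measure.restrict_apply (hτmono.measurable measurableSet_Iic),
      Measure.restrict_restrict measurableSet_Iic]
    rcases lt_or_ge c 0 with hc | hc
    · have e1 : τ ⁻¹' Iic c = ∅ := by
        ext u; simpa using hc.trans_le (hτ0 u)
      have e2 : Iic c ∩ Ioc 0 t = ∅ := by
        ext u; simp; intro h1 h2; linarith
      simp [e1, e2]
    · have e1 : τ ⁻¹' Iic c ∩ Ioc 0 (σ t) = Ioc 0 (σ (min c t)) := by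
        ext u
        simp only [mem_inter_iff, mem_preimage, mem_Iic, mem_Ioc]
        rw [← galois u t ht, ← galois u (min c t) (le_min hc ht), le_min_iff]
        tauto
      have e2 : Iic c ∩ Ioc 0 t = Ioc 0 (min c t) := by
        ext u; simp; tauto
      have hi := hρi (min c t) (le_min hc ht)
      rw [intervalIntegrable_iff_integrableOn_Ioc_of_le (le_min hc ht)] at hi
      rw [e1, e2, Real.volume_Ioc, sub_zero,
        ← ofReal_integral_eq_lintegral_ofReal hi (ae_of_all _ hρ0), hσ]
      simp only [intervalIntegral.integral_of_le (le_min hc ht)]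

theorem integral_comp_time_change {E : Type*} [NormedAddCommGroup E] [NormedSpace ℝ E]
    {ρ τ : ℝ → ℝ} {t u : ℝ} (hu : 0 ≤ u) (ht : 0 ≤ t) (hρm : Measurable ρ) (hρ0 : ∀ t, 0 ≤ ρ t)
    (hτ : Measurable τ)
    (hmap : Measure.map τ (volume.restrict (Ioc 0 u)) =
        (volume.restrict (Ioc 0 t)).withDensity fun r => ENNReal.ofReal (ρ r))
    {g : ℝ → E} (hg : StronglyMeasurable g) :
    ∫ s in (0 : ℝ)..u, g (τ s) = ∫ r in (0 : ℝ)..t, ρ r • g r := by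
  rw [intervalIntegral.integral_of_le hu, intervalIntegral.integral_of_le ht,
    ← integral_map hτ.aemeasurable hg.aestronglyMeasurable, hmap]
  rw [integral_withDensity_eq_integral_toReal_smul hρm.ennreal_ofReal (by simp)]
  simp [ENNReal.toReal_ofReal (hρ0 _)]

/-- A running cost `k` up to an exponential time has the same expectation as the
discounted running cost `k`, and a terminal cost `Q` amounts to the running cost `lam * Q`. -/
theorem integral_exp_mul_primitive_add {k Q : ℝ → ℝ} {lam B C : ℝ} (hlam : 0 < lam)
    (hk : Measurable k) (hQ : Measurable Q) (hkB : ∀ t, |k t| ≤ B) (hQC : ∀ t, |Q t| ≤ C) :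
    ∫ t in Ioi (0 : ℝ), lam * Real.exp (-lam * t) * ((∫ s in (0 : ℝ)..t, k s) + Q t) =
      ∫ t in Ioi (0 : ℝ), Real.exp (-lam * t) * (k t + lam * Q t) := by
  have hki : ∀ s t, IntervalIntegrable k volume s t := fun s t =>
    (intervalIntegrable_const (c := B)).mono_fun' hk.aestronglyMeasurable (ae_of_all _ hkB)
  have hQi : ∀ s t, IntervalIntegrable Q volume s t := fun s t =>
    (intervalIntegrable_const (c := C)).mono_fun' hQ.aestronglyMeasurable (ae_of_all _ hQC)
  have hIc : Continuous fun t => ∫ s in (0 : ℝ)..t, k s :=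
    intervalIntegral.continuous_primitive hki 0
  have hIb : ∀ t, 0 ≤ t → |∫ s in (0 : ℝ)..t, k s| ≤ B * t := fun t ht => by
    simpa [abs_of_nonneg ht] using
      intervalIntegral.norm_integral_le_of_norm_le_const (f := k) (a := 0) (b := t) (C := B)
        fun s _ => hkB s
  have hB : 0 ≤ B := (abs_nonneg _).trans (hkB 0)
  have e1 := exp_neg_integrableOn_Ioi 0 hlam
  have e2 := exp_neg_integrableOn_Ioi 0 (half_pos hlam)
  have hint1 : IntegrableOn (fun t => lam * Real.exp (-lam * t) * ((∫ s in (0 : ℝ)..t, k s) + Q t))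
      (Ioi 0) := by
    refine ((e2.const_mul (2 * B)).add (e1.const_mul (lam * C))).mono' ?_ ?_
    · exact (((by fun_prop : Continuous fun t : ℝ => lam * Real.exp (-lam * t)).measurable).mul
        (hIc.measurable.add hQ)).aestronglyMeasurable
    · filter_upwards [ae_restrict_mem measurableSet_Ioi] with t ht
      have ht0 : 0 ≤ t := le_of_lt ht
      have hexp : Real.exp (-lam * t) = Real.exp (-(lam / 2) * t) * Real.exp (-(lam / 2) * t) := by
        rw [← Real.exp_add]; ring_nf
      -- the linear growth of the primitive is absorbed by half of the exponential rate
      have hlin : lam * t * Real.exp (-(lam / 2) * t) ≤ 2 := by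
        have h1 : lam / 2 * t ≤ Real.exp (lam / 2 * t) := by
          linarith [Real.add_one_le_exp (lam / 2 * t)]
        have h2 : Real.exp (lam / 2 * t) * Real.exp (-(lam / 2) * t) = 1 := by
          rw [← Real.exp_add]; simp
        nlinarith [Real.exp_pos (-(lam / 2) * t)]
      have hE := Real.exp_pos (-(lam / 2) * t)
      calc ‖lam * Real.exp (-lam * t) * ((∫ s in (0 : ℝ)..t, k s) + Q t)‖
          = lam * Real.exp (-lam * t) * |(∫ s in (0 : ℝ)..t, k s) + Q t| := by
            rw [norm_mul, Real.norm_of_nonneg (by positivity), Real.norm_eq_abs]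
        _ ≤ lam * Real.exp (-lam * t) * (B * t + C) := by
            gcongr
            exact (abs_add_le _ _).trans (add_le_add (hIb t ht0) (hQC t))
        _ = B * Real.exp (-(lam / 2) * t) * (lam * t * Real.exp (-(lam / 2) * t)) +
              lam * C * Real.exp (-lam * t) := by rw [hexp]; ring
        _ ≤ B * Real.exp (-(lam / 2) * t) * 2 + lam * C * Real.exp (-lam * t) := by gcongr
        _ = _ := by simp; ring
  have hint2 : IntegrableOn (fun t => Real.exp (-lam * t) * (k t + lam * Q t)) (Ioi 0) := by
    refine (e1.mul_const (B + lam * C)).mono' ?_ ?_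
    · exact (((by fun_prop : Continuous fun t : ℝ => Real.exp (-lam * t)).measurable).mul
        (hk.add (hQ.const_mul lam))).aestronglyMeasurable
    · refine ae_of_all _ fun t => ?_
      rw [norm_mul, Real.norm_of_nonneg (Real.exp_pos _).le]
      gcongr
      refine (abs_add_le _ _).trans (add_le_add (hkB t) ?_)
      rw [abs_mul, abs_of_pos hlam]
      gcongr
      exact hQC t
  have l1 := intervalIntegral_tendsto_integral_Ioi 0 hint1 Filter.tendsto_id
  have l2 := intervalIntegral_tendsto_integral_Ioi 0 hint2 Filter.tendsto_id
  have l3 : Filter.Tendsto (fun T => Real.exp (-lam * T) * ∫ s in (0 : ℝ)..T, k s) Filter.atTop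
      (nhds 0) := by
    have h1 : Filter.Tendsto (fun T : ℝ => B / lam * (lam * T * Real.exp (-(lam * T))))
        Filter.atTop (nhds (B / lam * 0)) := by
      refine Filter.Tendsto.const_mul _ ?_
      have := (Real.tendsto_pow_mul_exp_neg_atTop_nhds_zero 1).comp
        (Filter.tendsto_id.const_mul_atTop hlam)
      simpa [Function.comp_def] using this
    rw [mul_zero] at h1
    refine squeeze_zero_norm' ?_ h1
    filter_upwards [Filter.eventually_ge_atTop 0] with T hT
    rw [norm_mul, Real.norm_of_nonneg (Real.exp_pos _).le]
    calc Real.exp (-lam * T) * ‖∫ s in (0 : ℝ)..T, k s‖ ≤ Real.exp (-lam * T) * (B * T) := by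
          gcongr; exact hIb T hT
      _ = _ := by field_simp
  refine tendsto_nhds_unique l1 ?_
  have l4 := l2.sub l3
  rw [sub_zero] at l4
  refine l4.congr fun T => ?_
  have hip := integral_exp_mul_primitive (hki 0 T) (-lam)
  have hc : Continuous fun t : ℝ => Real.exp (-lam * t) := by fun_prop
  have i1 : IntervalIntegrable (fun r => Real.exp (-lam * r) * k r) volume 0 T :=
    (hki 0 T).continuousOn_mul hc.continuousOn
  have i2 : IntervalIntegrable (fun r => Real.exp (-lam * r) * (lam * Q r)) volume 0 T :=
    ((hQi 0 T).const_mul lam).continuousOn_mul hc.continuousOn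
  have i3 : IntervalIntegrable (fun r => -lam * Real.exp (-lam * r) * ∫ s in (0 : ℝ)..r, k s)
      volume 0 T := by
    refine Continuous.intervalIntegrable ?_ _ _
    fun_prop
  simp only [id]
  have s1 : ∫ r in (0 : ℝ)..T, Real.exp (-lam * r) * (k r + lam * Q r) =
      (∫ r in (0 : ℝ)..T, Real.exp (-lam * r) * k r) +
        ∫ r in (0 : ℝ)..T, Real.exp (-lam * r) * (lam * Q r) := by
    rw [← intervalIntegral.integral_add i1 i2]
    simp only [mul_add]
  have s2 : ∫ t in (0 : ℝ)..T, lam * Real.exp (-lam * t) * ((∫ s in (0 : ℝ)..t, k s) + Q t) =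
      (∫ r in (0 : ℝ)..T, Real.exp (-lam * r) * (lam * Q r)) -
        ∫ r in (0 : ℝ)..T, -lam * Real.exp (-lam * r) * ∫ s in (0 : ℝ)..r, k s := by
    rw [← intervalIntegral.integral_sub i2 i3]
    refine intervalIntegral.integral_congr fun t _ => ?_
    ring
  rw [s1, s2, hip]
  ring

/-- Variation of constants, read backwards: the solution formula for the linear equation
`W' = c W - l`, `W 0 = C`, implies the equation in integrated form. -/
theorem eq_add_integral_of_eq_exp_mul {W l : ℝ → ℝ} {c C t : ℝ}
    (hl : IntervalIntegrable l volume 0 t) (ht : 0 ≤ t)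
    (hW : ∀ r, 0 ≤ r → W r = Real.exp (c * r) * (C - ∫ s in (0 : ℝ)..r, Real.exp (-c * s) * l s)) :
    IntervalIntegrable W volume 0 t ∧ W t = C + ∫ r in (0 : ℝ)..t, (c * W r - l r) := by
  have hcexp : ∀ c : ℝ, Continuous fun r : ℝ => Real.exp (c * r) := fun c => by fun_prop
  have hk : IntervalIntegrable (fun s => Real.exp (-c * s) * l s) volume 0 t :=
    hl.continuousOn_mul (hcexp _).continuousOn
  have hIcc : uIcc 0 t = Icc 0 t := uIcc_of_le ht
  have hprim : ContinuousOn (fun r => ∫ s in (0 : ℝ)..r, Real.exp (-c * s) * l s) (uIcc 0 t) := by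
    refine intervalIntegral.continuousOn_primitive_interval ?_
    rwa [hIcc, ← intervalIntegrable_iff_integrableOn_Icc_of_le ht]
  have hWc : ContinuousOn W (uIcc 0 t) := by
    refine ContinuousOn.congr
      ((hcexp c).continuousOn.mul ((continuousOn_const (c := C)).sub hprim)) ?_
    intro r hr
    rw [hIcc] at hr
    exact hW r hr.1
  refine ⟨hWc.intervalIntegrable, ?_⟩
  rw [intervalIntegral.integral_sub (hWc.intervalIntegrable.const_mul c) hl]
  have h1 : ∫ r in (0 : ℝ)..t, c * W r = (∫ r in (0 : ℝ)..t, C * (c * Real.exp (c * r))) -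
      ∫ r in (0 : ℝ)..t, c * Real.exp (c * r) * ∫ s in (0 : ℝ)..r, Real.exp (-c * s) * l s := by
    rw [← intervalIntegral.integral_sub
      (Continuous.intervalIntegrable (by fun_prop) _ _)
      (hprim.intervalIntegrable.continuousOn_mul (by fun_prop))]
    refine intervalIntegral.integral_congr fun r hr => ?_
    rw [hIcc] at hr
    simp only [hW r hr.1]
    ring
  have h2 : ∫ r in (0 : ℝ)..t, C * (c * Real.exp (c * r)) = C * (Real.exp (c * t) - 1) := by
    rw [intervalIntegral.integral_const_mul]
    congr 1
    rw [intervalIntegral.integral_eq_sub_of_hasDerivAt (f := fun r => Real.exp (c * r))]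
    · simp
    · intro r _
      simpa [mul_comm] using ((hasDerivAt_id r).const_mul c).exp
    · exact Continuous.intervalIntegrable (by fun_prop) _ _
  have h3 : ∫ r in (0 : ℝ)..t, Real.exp (c * r) * (Real.exp (-c * r) * l r) =
      ∫ r in (0 : ℝ)..t, l r := by
    refine intervalIntegral.integral_congr fun r _ => ?_
    rw [← mul_assoc, ← Real.exp_add]
    simp
  rw [h1, h2, integral_exp_mul_primitive hk c, h3, hW t ht]
  ring

/-! ### Costs, concatenation and the dynamic programming principle -/

namespace StoppingProblem

variable {n m : ℕ} {P : StoppingProblem n m} {q₁ q₂ K₁ K₂ : ℝ}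
  {x : EuclideanSpace ℝ (Fin n)} {a b : ℝ → EuclideanSpace ℝ (Fin m)}
  {y z : ℝ → EuclideanSpace ℝ (Fin n)}

/-- The assumptions of the setting that hold throughout: regular data, bounded costs, and a free
motionless control value. -/
structure Standing (P : StoppingProblem n m) (q₁ q₂ K₁ K₂ : ℝ) : Prop where
  reg : P.Regular
  terminal : P.TerminalCostBounds q₁ q₂
  running : P.RunningCostBounds K₁ K₂
  free : P.FreeMotionless

namespace Standing

theorem running_nonneg (h : P.Standing q₁ q₂ K₁ K₂) {x a} (hx : x ∈ closure P.Ω) (ha : a ∈ P.A) :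
    0 ≤ P.K x a := h.running.1.trans (h.running.2 x hx a ha).1

theorem running_le (h : P.Standing q₁ q₂ K₁ K₂) {x a} (hx : x ∈ closure P.Ω) (ha : a ∈ P.A) :
    P.K x a ≤ K₂ := (h.running.2 x hx a ha).2

theorem le_terminal (h : P.Standing q₁ q₂ K₁ K₂) (hx : x ∈ closure P.Ω) : q₁ ≤ P.q x :=
  h.terminal.1.2 ⟨x, hx, rfl⟩

theorem terminal_nonneg (h : P.Standing q₁ q₂ K₁ K₂) (hx : x ∈ closure P.Ω) : 0 ≤ P.q x :=
  h.terminal.2.1.trans (h.le_terminal hx)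

theorem terminal_le (h : P.Standing q₁ q₂ K₁ K₂) (hx : x ∈ closure P.Ω) : P.q x ≤ q₂ :=
  h.terminal.2.2 x hx

theorem lam_pos (h : P.Standing q₁ q₂ K₁ K₂) : 0 < P.lam := h.reg.lam_pos

theorem K₂_nonneg (h : P.Standing q₁ q₂ K₁ K₂) : 0 ≤ K₂ := by
  obtain ⟨x, hx, -⟩ := h.terminal.1.1
  exact (h.running_nonneg hx h.reg.a₀_mem).trans (h.running_le hx h.reg.a₀_mem)

theorem q₂_nonneg (h : P.Standing q₁ q₂ K₁ K₂) : 0 ≤ q₂ := by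
  obtain ⟨x, hx, -⟩ := h.terminal.1.1
  exact (h.terminal_nonneg hx).trans (h.terminal_le hx)

theorem rate_nonneg (h : P.Standing q₁ q₂ K₁ K₂) : 0 ≤ K₂ + P.lam * q₂ :=
  add_nonneg h.K₂_nonneg (mul_nonneg h.lam_pos.le h.q₂_nonneg)

theorem continuousOn_f (h : P.Standing q₁ q₂ K₁ K₂) :
    ContinuousOn (fun p : _ × _ => P.f p.1 p.2) (closure P.Ω ×ˢ P.A) := by
  obtain ⟨L, hL⟩ := h.reg.lipschitz_f
  exact continuousOn_prod_of_continuousOn_lipschitzOnWith _ L h.reg.continuous_f hL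

theorem exists_norm_f_le (h : P.Standing q₁ q₂ K₁ K₂) :
    ∃ F, ∀ x ∈ closure P.Ω, ∀ a ∈ P.A, ‖P.f x a‖ ≤ F := by
  obtain ⟨F, hF⟩ := (h.reg.isBounded_Ω.isCompact_closure.prod
    h.reg.isCompact_A).exists_bound_of_continuousOn h.continuousOn_f
  exact ⟨F, fun x hx a ha => hF (x, a) ⟨hx, ha⟩⟩

theorem measurable_f_comp (h : P.Standing q₁ q₂ K₁ K₂) (hy : Measurable y)
    (hyc : ∀ t, y t ∈ closure P.Ω) (ha : P.IsControl a) : Measurable fun t => P.f (y t) (a t) :=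
  (continuousOn_iff_continuous_domRestrict.1 h.continuousOn_f).measurable.comp
    ((hy.prodMk ha.1).subtype_mk (h := fun t => ⟨hyc t, ha.2 t⟩))

theorem measurable_K_comp (h : P.Standing q₁ q₂ K₁ K₂) (hy : Measurable y)
    (hyc : ∀ t, y t ∈ closure P.Ω) (ha : P.IsControl a) : Measurable fun t => P.K (y t) (a t) :=
  (lowerSemicontinuous_restrict_iff.2 h.reg.lsc_K).measurable.comp
    ((hy.prodMk ha.1).subtype_mk (h := fun t => ⟨hyc t, ha.2 t⟩))

theorem measurable_q_comp (h : P.Standing q₁ q₂ K₁ K₂) (hy : Measurable y)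
    (hyc : ∀ t, y t ∈ closure P.Ω) : Measurable fun t => P.q (y t) :=
  (lowerSemicontinuous_restrict_iff.2 h.reg.lsc_q).measurable.comp (hy.subtype_mk (h := hyc))

end Standing

/-- The rate `K + λ q` at which a control incurs expected cost, before discounting. -/
noncomputable def effCost (P : StoppingProblem n m) (a : ℝ → EuclideanSpace ℝ (Fin m))
    (y : ℝ → EuclideanSpace ℝ (Fin n)) (t : ℝ) : ℝ :=
  P.K (y t) (a t) + P.lam * P.q (y t)

theorem IsAdmissible.apply_zero (hay : P.IsAdmissible x a y) : y 0 = x := by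
  simpa using hay.eq_integral 0 le_rfl

/-- The trajectory, frozen before time `0`, is continuous at all times. -/
theorem IsAdmissible.continuous_comp_max (hay : P.IsAdmissible x a y) :
    Continuous fun t => y (max t 0) :=
  hay.continuousOn.comp_continuous (by fun_prop) fun t => le_max_right t 0

theorem IsAdmissible.comp_max_mem (hay : P.IsAdmissible x a y) (t : ℝ) :
    y (max t 0) ∈ closure P.Ω := hay.mem_closure _ (le_max_right t 0)

theorem effCost_comp_max {t : ℝ} (ht : 0 ≤ t) :
    P.effCost a (fun t => y (max t 0)) t = P.effCost a y t := by
  simp [effCost, max_eq_left ht]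

namespace Standing

theorem effCost_nonneg (h : P.Standing q₁ q₂ K₁ K₂) {t : ℝ} (hy : y t ∈ closure P.Ω)
    (ha : a t ∈ P.A) : 0 ≤ P.effCost a y t :=
  add_nonneg (h.running_nonneg hy ha) (mul_nonneg h.lam_pos.le (h.terminal_nonneg hy))

theorem effCost_le (h : P.Standing q₁ q₂ K₁ K₂) {t : ℝ} (hy : y t ∈ closure P.Ω)
    (ha : a t ∈ P.A) : P.effCost a y t ≤ K₂ + P.lam * q₂ :=
  add_le_add (h.running_le hy ha) (mul_le_mul_of_nonneg_left (h.terminal_le hy) h.lam_pos.le)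

theorem aestronglyMeasurable_effCost (h : P.Standing q₁ q₂ K₁ K₂) (hay : P.IsAdmissible x a y) :
    AEStronglyMeasurable (P.effCost a y) (volume.restrict (Ici 0)) := by
  have hm := hay.continuous_comp_max.measurable
  refine AEStronglyMeasurable.congr (f := P.effCost a fun t => y (max t 0)) ?_ ?_
  · exact ((h.measurable_K_comp hm hay.comp_max_mem hay.isControl).add
      ((h.measurable_q_comp hm hay.comp_max_mem).const_mul _)).aestronglyMeasurable
  · filter_upwards [ae_restrict_mem measurableSet_Ici] with t ht using effCost_comp_max ht

theorem integrableOn_effCost (h : P.Standing q₁ q₂ K₁ K₂) (hay : P.IsAdmissible x a y) :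
    IntegrableOn (fun t => Real.exp (-P.lam * t) * P.effCost a y t) (Ioi 0) := by
  refine ((exp_neg_integrableOn_Ioi 0 h.lam_pos).mul_const (K₂ + P.lam * q₂)).mono' ?_ ?_
  · exact (by fun_prop : Continuous fun t : ℝ => Real.exp (-P.lam * t)).aestronglyMeasurable.mul
      ((h.aestronglyMeasurable_effCost hay).mono_set Ioi_subset_Ici_self)
  · filter_upwards [ae_restrict_mem measurableSet_Ioi] with t ht
    have hm := hay.mem_closure t (le_of_lt ht)
    rw [norm_mul, Real.norm_of_nonneg (Real.exp_pos _).le,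
      Real.norm_of_nonneg (h.effCost_nonneg hm (hay.isControl.2 t))]
    gcongr
    exact h.effCost_le hm (hay.isControl.2 t)

theorem intervalIntegrable_effCost (h : P.Standing q₁ q₂ K₁ K₂) (hay : P.IsAdmissible x a y)
    {s t : ℝ} (hs : 0 ≤ s) (ht : 0 ≤ t) : IntervalIntegrable (P.effCost a y) volume s t := by
  have hsub : uIoc s t ⊆ Ici 0 := fun r hr => (le_min hs ht).trans hr.1.le
  refine (intervalIntegrable_const (c := K₂ + P.lam * q₂)).mono_fun'
    ((h.aestronglyMeasurable_effCost hay).mono_set hsub) ?_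
  filter_upwards [ae_restrict_mem measurableSet_uIoc] with r hr
  have hm := hay.mem_closure r (hsub hr)
  rw [Real.norm_of_nonneg (h.effCost_nonneg hm (hay.isControl.2 r))]
  exact h.effCost_le hm (hay.isControl.2 r)

/-- Integration by parts turns the expectation over the termination time into
the discounted integral of `K + λ q`. -/
theorem cost_eq (h : P.Standing q₁ q₂ K₁ K₂) (hay : P.IsAdmissible x a y) :
    P.cost a y = ∫ t in Ioi (0 : ℝ), Real.exp (-P.lam * t) * P.effCost a y t := by
  have hm := hay.continuous_comp_max.measurable
  have key := integral_exp_mul_primitive_add (B := K₂) (C := q₂) h.lam_pos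
    (h.measurable_K_comp hm hay.comp_max_mem hay.isControl)
    (h.measurable_q_comp hm hay.comp_max_mem)
    (fun t => abs_le.2 ⟨(neg_nonpos.2 h.K₂_nonneg).trans
      (h.running_nonneg (hay.comp_max_mem t) (hay.isControl.2 t)),
      h.running_le (hay.comp_max_mem t) (hay.isControl.2 t)⟩)
    (fun t => abs_le.2 ⟨(neg_nonpos.2 h.q₂_nonneg).trans
      (h.terminal_nonneg (hay.comp_max_mem t)),
      h.terminal_le (hay.comp_max_mem t)⟩)
  refine Eq.trans (setIntegral_congr_fun measurableSet_Ioi fun t ht => ?_)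
    (key.trans (setIntegral_congr_fun measurableSet_Ioi fun t ht => ?_))
  · have ht' : 0 ≤ t := le_of_lt ht
    simp only [costAt, max_eq_left ht']
    congr 2
    refine intervalIntegral.integral_congr fun s hs => ?_
    rw [uIcc_of_le ht'] at hs
    simp [max_eq_left hs.1]
  · simp [effCost, max_eq_left (le_of_lt (mem_Ioi.1 ht))]

theorem cost_nonneg (h : P.Standing q₁ q₂ K₁ K₂) (hay : P.IsAdmissible x a y) :
    0 ≤ P.cost a y := by
  rw [h.cost_eq hay]
  exact setIntegral_nonneg measurableSet_Ioi fun t ht => mul_nonneg (Real.exp_pos _).le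
    (h.effCost_nonneg (hay.mem_closure t (le_of_lt ht)) (hay.isControl.2 t))

theorem integral_exp (h : P.Standing q₁ q₂ K₁ K₂) (c : ℝ) :
    ∫ t in Ioi (0 : ℝ), Real.exp (-P.lam * t) * (P.lam * c) = c := by
  have h2 := integral_exp_mul_Ioi (a := -P.lam) (by linarith [h.lam_pos]) 0
  rw [integral_mul_const, h2]
  have := h.lam_pos.ne'
  simp
  field_simp

theorem le_cost (h : P.Standing q₁ q₂ K₁ K₂) (hay : P.IsAdmissible x a y) : q₁ ≤ P.cost a y := by
  rw [h.cost_eq hay, ← h.integral_exp q₁]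
  refine setIntegral_mono_on ?_ (h.integrableOn_effCost hay) measurableSet_Ioi fun t ht => ?_
  · exact (exp_neg_integrableOn_Ioi 0 h.lam_pos).mul_const _
  · have hm := hay.mem_closure t (le_of_lt ht)
    have := h.running_nonneg hm (hay.isControl.2 t)
    have := mul_le_mul_of_nonneg_left (h.le_terminal hm) h.lam_pos.le
    gcongr
    unfold effCost
    linarith

theorem isAdmissible_const (h : P.Standing q₁ q₂ K₁ K₂) (hx : x ∈ closure P.Ω) :
    P.IsAdmissible x (fun _ => P.a₀) (fun _ => x) where
  isControl := ⟨measurable_const, fun _ => h.reg.a₀_mem⟩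
  continuousOn := continuousOn_const
  mem_closure _ _ := hx
  intervalIntegrable _ _ := intervalIntegrable_const
  eq_integral t _ := by simp [h.free.1 x hx]

theorem cost_const (h : P.Standing q₁ q₂ K₁ K₂) (hx : x ∈ closure P.Ω) :
    P.cost (fun _ => P.a₀) (fun _ => x) = P.q x := by
  rw [h.cost_eq (h.isAdmissible_const hx)]
  simpa [effCost, h.free.2 x hx] using h.integral_exp (P.q x)

theorem value_le_cost (h : P.Standing q₁ q₂ K₁ K₂) (hay : P.IsAdmissible x a y) :
    P.value x ≤ P.cost a y :=
  csInf_le ⟨q₁, by rintro c ⟨a, y, hay, rfl⟩; exact h.le_cost hay⟩ ⟨a, y, hay, rfl⟩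

theorem le_value (h : P.Standing q₁ q₂ K₁ K₂) (hx : x ∈ closure P.Ω) {c : ℝ}
    (hc : ∀ a y, P.IsAdmissible x a y → c ≤ P.cost a y) : c ≤ P.value x :=
  le_csInf ⟨_, _, _, h.isAdmissible_const hx, rfl⟩ (by rintro c ⟨a, y, hay, rfl⟩; exact hc a y hay)

theorem value_le_terminal (h : P.Standing q₁ q₂ K₁ K₂) (hx : x ∈ closure P.Ω) :
    P.value x ≤ P.q x := by
  rw [← h.cost_const hx]; exact h.value_le_cost (h.isAdmissible_const hx)

theorem value_mem_Icc (h : P.Standing q₁ q₂ K₁ K₂) (hx : x ∈ closure P.Ω) :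
    P.value x ∈ Icc q₁ (P.q x) :=
  ⟨h.le_value hx fun _ _ hay => h.le_cost hay, h.value_le_terminal hx⟩

/-- Only `q ≤ v` is at stake in the definition of the motionless set, as resting costs `q`. -/
theorem mem_motionlessSet (h : P.Standing q₁ q₂ K₁ K₂) (hx : x ∈ closure P.Ω)
    (hv : P.q x ≤ P.value x) : x ∈ P.motionlessSet := by
  have := le_antisymm (h.value_le_terminal hx) hv
  exact ⟨hx, by rw [h.cost_const hx, this], this⟩

end Standing

theorem IsAdmissible.shift (hay : P.IsAdmissible x a y) {T : ℝ} (hT : 0 ≤ T) :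
    P.IsAdmissible (y T) (fun t => a (t + T)) (fun t => y (t + T)) where
  isControl := ⟨hay.isControl.1.comp (measurable_add_const T), fun t => hay.isControl.2 _⟩
  continuousOn := hay.continuousOn.comp (by fun_prop) fun t ht => add_nonneg ht hT
  mem_closure t ht := hay.mem_closure _ (add_nonneg ht hT)
  intervalIntegrable t ht := by
    have := (hay.intervalIntegrable T hT).symm.trans (hay.intervalIntegrable _ (add_nonneg ht hT))
    simpa using this.comp_add_right T
  eq_integral t ht := by
    rw [intervalIntegral.integral_comp_add_right (fun s => P.f (y s) (a s)), zero_add,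
      hay.eq_integral _ (add_nonneg ht hT), hay.eq_integral T hT, add_assoc,
      intervalIntegral.integral_add_adjacent_intervals (hay.intervalIntegrable T hT)
        ((hay.intervalIntegrable T hT).symm.trans (hay.intervalIntegrable _ (add_nonneg ht hT)))]

/-- The control `a` up to time `T`, followed by a control `b` that is admissible at `y T`. -/
theorem IsAdmissible.concat (hay : P.IsAdmissible x a y) {T : ℝ} (hT : 0 ≤ T)
    (hbz : P.IsAdmissible (y T) b z) :
    P.IsAdmissible x (fun t => if t < T then a t else b (t - T))
      (fun t => if t < T then y t else z (t - T)) := by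
  set c := fun t => if t < T then a t else b (t - T) with hc
  set w := fun t => if t < T then y t else z (t - T) with hw
  have hwy : ∀ t, t ≤ T → w t = y t := by
    intro t ht
    rcases ht.lt_or_eq with ht | rfl
    · simp [hw, ht]
    · simp [hw, hbz.apply_zero]
  have hwz : ∀ t, 0 ≤ t → w (t + T) = z t := fun t ht => by simp [hw, not_lt.2 ht]
  have hca : ∀ t, t < T → c t = a t := fun t ht => by simp [hc, ht]
  have hcb : ∀ t, 0 ≤ t → c (t + T) = b t := fun t ht => by simp [hc, not_lt.2 ht]
  have e1 : ∀ t, 0 ≤ t → t ≤ T → EqOn (fun s => P.f (y s) (a s)) (fun s => P.f (w s) (c s))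
      (Ioo 0 t) := fun t _ htT s hs => by
    simp only [hwy s (hs.2.le.trans htT), hca s (hs.2.trans_le htT)]
  have e2 : ∀ t, 0 ≤ t → EqOn (fun s => P.f (z s) (b s)) (fun s => P.f (w (s + T)) (c (s + T)))
      (Ioo 0 t) := fun t _ s hs => by simp only [hwz s hs.1.le, hcb s hs.1.le]
  have i1 : ∀ t, 0 ≤ t → t ≤ T →
      IntervalIntegrable (fun s => P.f (w s) (c s)) volume 0 t := fun t ht htT => by
    refine (hay.intervalIntegrable t ht).congr_ae ?_
    rw [uIoc_of_le ht, ← restrict_Ioo_eq_restrict_Ioc]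
    filter_upwards [ae_restrict_mem measurableSet_Ioo] with s hs using e1 t ht htT hs
  have i2 : ∀ t, 0 ≤ t →
      IntervalIntegrable (fun s => P.f (w s) (c s)) volume T (t + T) := fun t ht => by
    have : IntervalIntegrable (fun s => P.f (w (s + T)) (c (s + T))) volume 0 t := by
      refine (hbz.intervalIntegrable t ht).congr_ae ?_
      rw [uIoc_of_le ht, ← restrict_Ioo_eq_restrict_Ioc]
      filter_upwards [ae_restrict_mem measurableSet_Ioo] with s hs using e2 t ht hs
    simpa using this.comp_sub_right T
  have v1 : ∀ t, 0 ≤ t → t ≤ T → w t = x + ∫ s in (0 : ℝ)..t, P.f (w s) (c s) := by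
    intro t ht htT
    rw [hwy t htT, hay.eq_integral t ht]
    simp only [intervalIntegral.integral_of_le ht, integral_Ioc_eq_integral_Ioo]
    rw [setIntegral_congr_fun measurableSet_Ioo (e1 t ht htT)]
  have v2 : ∀ t, 0 ≤ t → w (t + T) = y T + ∫ s in T..(t + T), P.f (w s) (c s) := by
    intro t ht
    have := intervalIntegral.integral_comp_add_right (a := 0) (b := t)
      (fun s => P.f (w s) (c s)) T
    rw [zero_add] at this
    rw [← this, hwz t ht, hbz.eq_integral t ht]
    simp only [intervalIntegral.integral_of_le ht, integral_Ioc_eq_integral_Ioo]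
    rw [setIntegral_congr_fun measurableSet_Ioo (e2 t ht)]
  refine ⟨⟨?_, fun t => ?_⟩, ?_, fun t ht => ?_, fun t ht => ?_, fun t ht => ?_⟩
  · exact Measurable.ite measurableSet_Iio hay.isControl.1
      (hbz.isControl.1.comp (measurable_sub_const T))
  · rcases lt_or_ge t T with h | h
    · rw [hca t h]; exact hay.isControl.2 t
    · simp only [hc, if_neg (not_lt.2 h)]; exact hbz.isControl.2 _
  · have hcov : Ici (0 : ℝ) = Icc 0 T ∪ Ici T := (Icc_union_Ici_eq_Ici hT).symm
    rw [hcov]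
    refine ContinuousOn.union_of_isClosed ?_ ?_ isClosed_Icc isClosed_Ici
    · exact (hay.continuousOn.mono Icc_subset_Ici_self).congr fun t ht => hwy t ht.2
    · refine (hbz.continuousOn.comp (f := fun t => t - T) (by fun_prop)
        fun t (ht : T ≤ t) => sub_nonneg.2 ht).congr fun t ht => ?_
      simp [hw, not_lt.2 (show T ≤ t from ht)]
  · rcases lt_or_ge t T with h | h
    · rw [hwy t h.le]; exact hay.mem_closure t ht
    · rw [← sub_add_cancel t T, hwz _ (sub_nonneg.2 h)]; exact hbz.mem_closure _ (sub_nonneg.2 h)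
  · rcases lt_or_ge t T with h | h
    · exact i1 t ht h.le
    · have := i2 (t - T) (sub_nonneg.2 h)
      rw [sub_add_cancel] at this
      exact (i1 T hT le_rfl).trans this
  · rcases lt_or_ge t T with h | h
    · exact v1 t ht h.le
    · have hi := i2 (t - T) (sub_nonneg.2 h)
      have hv := v2 (t - T) (sub_nonneg.2 h)
      rw [sub_add_cancel] at hi hv
      rw [hv, ← intervalIntegral.integral_add_adjacent_intervals (i1 T hT le_rfl) hi, ← add_assoc,
        ← v1 T hT le_rfl, hwy T le_rfl]

theorem cost_congr {a' y'} (ha : ∀ t, 0 < t → a t = a' t) (hy : ∀ t, 0 < t → y t = y' t) :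
    P.cost a y = P.cost a' y' := by
  refine setIntegral_congr_fun measurableSet_Ioi fun t ht => ?_
  have ht' : (0 : ℝ) ≤ t := le_of_lt ht
  simp only [costAt, hy t ht]
  congr 2
  simp only [intervalIntegral.integral_of_le ht']
  refine setIntegral_congr_fun measurableSet_Ioc fun s hs => ?_
  simp only [hy s hs.1, ha s hs.1]

namespace Standing

theorem cost_eq_integral_add (h : P.Standing q₁ q₂ K₁ K₂) (hay : P.IsAdmissible x a y) {T : ℝ}
    (hT : 0 ≤ T) :
    P.cost a y = (∫ t in (0 : ℝ)..T, Real.exp (-P.lam * t) * P.effCost a y t) +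
      Real.exp (-P.lam * T) * P.cost (fun t => a (t + T)) (fun t => y (t + T)) := by
  rw [h.cost_eq hay, h.cost_eq (hay.shift hT)]
  have hint := h.integrableOn_effCost hay
  rw [intervalIntegral.integral_of_le hT, ← Ioc_union_Ioi_eq_Ioi hT,
    setIntegral_union Ioc_disjoint_Ioi_same measurableSet_Ioi
      (hint.mono_set Ioc_subset_Ioi_self) (hint.mono_set (Ioi_subset_Ioi hT)),
    ← integral_const_mul, Ioc_union_Ioi_eq_Ioi hT]
  congr 1
  rw [← (measurePreserving_add_right volume T).setIntegral_preimage_emb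
    (measurableEmbedding_addRight T), preimage_add_const_Ioi, sub_self]
  refine setIntegral_congr_fun measurableSet_Ioi fun t _ => ?_
  simp only [effCost, mul_add, Real.exp_add]
  ring

theorem cost_concat (h : P.Standing q₁ q₂ K₁ K₂) (hay : P.IsAdmissible x a y) {T : ℝ}
    (hT : 0 ≤ T) (hbz : P.IsAdmissible (y T) b z) :
    P.cost (fun t => if t < T then a t else b (t - T))
        (fun t => if t < T then y t else z (t - T)) =
      (∫ t in (0 : ℝ)..T, Real.exp (-P.lam * t) * P.effCost a y t) +
        Real.exp (-P.lam * T) * P.cost b z := by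
  rw [h.cost_eq_integral_add (hay.concat hT hbz) hT]
  congr 1
  · simp only [intervalIntegral.integral_of_le hT, integral_Ioc_eq_integral_Ioo]
    refine setIntegral_congr_fun measurableSet_Ioo fun t ht => ?_
    simp only [effCost, if_pos ht.2]
  · congr 1
    exact cost_congr (fun t ht => by simp [not_lt.2 ht.le]) fun t ht => by simp [not_lt.2 ht.le]

/-- Dynamic programming inequality along an arbitrary admissible trajectory. -/
theorem value_le_integral_add (h : P.Standing q₁ q₂ K₁ K₂) (hay : P.IsAdmissible x a y) {T : ℝ}
    (hT : 0 ≤ T) :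
    P.value x ≤ (∫ t in (0 : ℝ)..T, Real.exp (-P.lam * t) * P.effCost a y t) +
      Real.exp (-P.lam * T) * P.value (y T) := by
  set I := ∫ t in (0 : ℝ)..T, Real.exp (-P.lam * t) * P.effCost a y t
  have hE := Real.exp_pos (-P.lam * T)
  have : (P.value x - I) / Real.exp (-P.lam * T) ≤ P.value (y T) := by
    refine h.le_value (hay.mem_closure T hT) fun b z hbz => ?_
    rw [div_le_iff₀ hE, mul_comm]
    have := h.value_le_cost (hay.concat hT hbz)
    rw [h.cost_concat hay hT hbz] at this
    linarith
  rw [div_le_iff₀ hE] at this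
  linarith

/-- A point that can be reached in time `T` has a value smaller by at most `(K₂ + λ q₂) T`. -/
theorem value_le_add (h : P.Standing q₁ q₂ K₁ K₂) (hay : P.IsAdmissible x a y) {T : ℝ}
    (hT : 0 ≤ T) : P.value x ≤ (K₂ + P.lam * q₂) * T + P.value (y T) := by
  refine (h.value_le_integral_add hay hT).trans (add_le_add ?_ ?_)
  · have : ∫ t in (0 : ℝ)..T, Real.exp (-P.lam * t) * P.effCost a y t ≤
        ∫ _ in (0 : ℝ)..T, (K₂ + P.lam * q₂) := by
      refine intervalIntegral.integral_mono_on hT ?_ intervalIntegrable_const fun t ht => ?_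
      · exact (h.intervalIntegrable_effCost hay le_rfl hT).continuousOn_mul (by fun_prop)
      · have hm := hay.mem_closure t ht.1
        have h1 := h.effCost_le (y := y) hm (hay.isControl.2 t)
        have h2 := h.effCost_nonneg (y := y) hm (hay.isControl.2 t)
        have h3 : Real.exp (-P.lam * t) ≤ 1 := by
          rw [Real.exp_le_one_iff, neg_mul, neg_nonpos]
          exact mul_nonneg h.lam_pos.le ht.1
        exact (mul_le_of_le_one_left h2 h3).trans h1
    rwa [intervalIntegral.integral_const, sub_zero, smul_eq_mul, mul_comm T] at this
  · have h2 : 0 ≤ P.value (y T) :=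
      h.terminal.2.1.trans (h.value_mem_Icc (hay.mem_closure T hT)).1
    refine mul_le_of_le_one_left h2 ?_
    rw [Real.exp_le_one_iff, neg_mul, neg_nonpos]
    exact mul_nonneg h.lam_pos.le hT

/-- Stopping an admissible control at time `T`. -/
theorem isAdmissible_stopControl (h : P.Standing q₁ q₂ K₁ K₂) (hay : P.IsAdmissible x a y) {T : ℝ}
    (hT : 0 ≤ T) : P.IsAdmissible x (P.stopControl a T) (fun t => y (min t T)) ∧
      P.cost (P.stopControl a T) (fun t => y (min t T)) =
        (∫ t in (0 : ℝ)..T, Real.exp (-P.lam * t) * P.effCost a y t) +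
          Real.exp (-P.lam * T) * P.q (y T) := by
  have hm := hay.mem_closure T hT
  have e : (fun t => y (min t T)) = fun t => if t < T then y t else (fun _ => y T) (t - T) := by
    funext t
    split_ifs with ht
    · rw [min_eq_left ht.le]
    · rw [min_eq_right (not_lt.1 ht)]
  rw [e, ← h.cost_const hm]
  exact ⟨hay.concat hT (h.isAdmissible_const hm), h.cost_concat hay hT (h.isAdmissible_const hm)⟩

/-! ### Reparametrization of paths -/

/-- Reparametrization of paths. If a path has velocity `ρ • f (y, α)` with `ρ ≥ 0`, then it can be
travelled by an admissible trajectory in time `∫ ρ`: in the new clock `∫ ρ`, the control `α` drives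
the system along the path. -/
theorem exists_isAdmissible_of_eq_integral_smul (h : P.Standing q₁ q₂ K₁ K₂)
    {α : ℝ → EuclideanSpace ℝ (Fin m)} {ρ : ℝ → ℝ} {T : ℝ} (hT : 0 ≤ T) (hα : P.IsControl α)
    (hρm : Measurable ρ) (hρ0 : ∀ t, 0 ≤ ρ t) (hρi : IntervalIntegrable ρ volume 0 T)
    (hy : ContinuousOn y (Icc 0 T)) (hyc : ∀ t ∈ Icc 0 T, y t ∈ closure P.Ω)
    (heq : ∀ t ∈ Icc 0 T, y t = x + ∫ s in (0 : ℝ)..t, ρ s • P.f (y s) (α s)) :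
    ∃ b z, P.IsAdmissible x b z ∧ z (∫ s in (0 : ℝ)..T, ρ s) = y T := by
  -- after time `T` the path is continued by resting, in the original clock
  set ρ' : ℝ → ℝ := (Iic T).piecewise ρ (fun _ => 1) with hρ'
  set α' : ℝ → EuclideanSpace ℝ (Fin m) := (Iic T).piecewise α (fun _ => P.a₀) with hα'
  set y' : ℝ → EuclideanSpace ℝ (Fin n) := fun t => y (max 0 (min t T)) with hy'
  have hclamp : ∀ t, max 0 (min t T) ∈ Icc 0 T := fun t =>
    ⟨le_max_left _ _, max_le hT (min_le_right _ _)⟩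
  have hy'c : Continuous y' := hy.comp_continuous (by fun_prop) hclamp
  have hy'm : ∀ t, y' t ∈ closure P.Ω := fun t => hyc _ (hclamp t)
  have hy'y : ∀ t ∈ Icc 0 T, y' t = y t := fun t ht => by
    simp [hy', min_eq_left ht.2, max_eq_right ht.1]
  have hα'c : P.IsControl α' := by
    refine ⟨hα.1.piecewise measurableSet_Iic measurable_const, fun t => ?_⟩
    by_cases ht : t ≤ T
    · simpa [hα', ht] using hα.2 t
    · simpa [hα', ht] using h.reg.a₀_mem
  have hρ'm : Measurable ρ' := hρm.piecewise measurableSet_Iic measurable_const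
  have hρ'0 : ∀ t, 0 ≤ ρ' t := fun t => by
    by_cases ht : t ≤ T
    · simpa [hρ', ht] using hρ0 t
    · simp [hρ', ht]
  have hρ'i : ∀ t, 0 ≤ t → IntervalIntegrable ρ' volume 0 t := fun t ht => by
    rw [intervalIntegrable_iff_integrableOn_Ioc_of_le ht]
    refine Integrable.piecewise measurableSet_Iic ?_ ?_
    · rw [IntegrableOn, Measure.restrict_restrict measurableSet_Iic]
      rw [intervalIntegrable_iff_integrableOn_Ioc_of_le hT] at hρi
      exact hρi.mono_set fun s hs => ⟨hs.2.1, hs.1⟩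
    · exact Integrable.integrableOn (integrable_const _)
  have hρ'T : ∫ s in (0 : ℝ)..T, ρ' s = ∫ s in (0 : ℝ)..T, ρ s := by
    refine intervalIntegral.integral_congr fun s hs => ?_
    rw [uIcc_of_le hT] at hs
    simp [hρ', hs.2]
  have hinf : ∀ u : ℝ, ∃ t, 0 ≤ t ∧ u ≤ ∫ s in (0 : ℝ)..t, ρ' s := fun u => by
    have hle : T ≤ T + max u 0 := le_add_of_nonneg_right (le_max_right _ _)
    refine ⟨T + max u 0, hT.trans hle, ?_⟩
    have hTi := (hρ'i T hT).symm.trans (hρ'i _ (hT.trans hle))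
    rw [← intervalIntegral.integral_add_adjacent_intervals (hρ'i T hT) hTi]
    have h1 : ∫ s in T..(T + max u 0), ρ' s = max u 0 := by
      rw [intervalIntegral.integral_of_le hle,
        setIntegral_congr_fun (g := fun _ => (1 : ℝ)) measurableSet_Ioc
          fun s hs => by simp [hρ', not_le.2 hs.1]]
      simp
    have h0 : 0 ≤ ∫ s in (0 : ℝ)..T, ρ' s :=
      intervalIntegral.integral_nonneg hT fun s _ => hρ'0 s
    rw [h1]
    linarith [le_max_left u 0]
  have heq' : ∀ t, 0 ≤ t → y' t = x + ∫ s in (0 : ℝ)..t, ρ' s • P.f (y' s) (α' s) := by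
    have base : ∀ t ∈ Icc 0 T, y' t = x + ∫ s in (0 : ℝ)..t, ρ' s • P.f (y' s) (α' s) := by
      intro t ht
      rw [hy'y t ht, heq t ht]
      congr 1
      refine intervalIntegral.integral_congr fun s hs => ?_
      rw [uIcc_of_le ht.1] at hs
      have hs' : s ∈ Icc 0 T := ⟨hs.1, hs.2.trans ht.2⟩
      simp [hρ', hα', hs'.2, hy'y s hs']
    intro t ht
    rcases le_total t T with htT | htT
    · exact base t ⟨ht, htT⟩
    · have hyt : y' t = y' T := by simp [hy', min_eq_right htT]
      rw [hyt, base T ⟨hT, le_rfl⟩, intervalIntegral.integral_of_le hT,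
        intervalIntegral.integral_of_le ht]
      congr 1
      refine (setIntegral_eq_of_subset_of_forall_sdiff_eq_zero measurableSet_Ioc
        (Ioc_subset_Ioc_right htT) fun s hs => ?_).symm
      have hs' : ¬ s ≤ T := fun hsT => hs.2 ⟨hs.1.1, hsT⟩
      simp [hα', hs', h.free.1 _ (hy'm s)]
  obtain ⟨τ, hτm, hτ0, hτσ, hmap⟩ := exists_time_change hρ'0 hρ'i hinf
  have hgm : Measurable fun t => P.f (y' t) (α' t) := h.measurable_f_comp hy'c.measurable hy'm hα'c
  obtain ⟨F, hF⟩ := h.exists_norm_f_le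
  have hgi : ∀ s t, IntervalIntegrable (fun u => P.f (y' (τ u)) (α' (τ u))) volume s t :=
    fun s t => (intervalIntegrable_const (c := F)).mono_fun'
      (hgm.comp hτm).aestronglyMeasurable (ae_of_all _ fun u => hF _ (hy'm _) _ (hα'c.2 _))
  have htc : ∀ t, 0 ≤ t → y' t = x + ∫ s in (0 : ℝ)..(∫ s in (0 : ℝ)..t, ρ' s),
      P.f (y' (τ s)) (α' (τ s)) := fun t ht => by
    rw [integral_comp_time_change (g := fun t => P.f (y' t) (α' t))
      (intervalIntegral.integral_nonneg ht fun s _ => hρ'0 s) ht hρ'm hρ'0 hτm (hmap t ht)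
      hgm.stronglyMeasurable]
    exact heq' t ht
  have hz : ∀ u, 0 ≤ u → y' (τ u) = x + ∫ s in (0 : ℝ)..u, P.f (y' (τ s)) (α' (τ s)) :=
    fun u hu => by
      have := htc (τ u) (hτ0 u)
      rwa [hτσ u hu] at this
  refine ⟨fun u => α' (τ u), fun u => y' (τ u), ⟨⟨hα'c.1.comp hτm, fun u => hα'c.2 _⟩, ?_,
    fun u _ => hy'm _, fun u _ => hgi 0 u, hz⟩, ?_⟩
  · exact ((continuous_const.add (intervalIntegral.continuous_primitive hgi 0)).continuousOn).congr
      fun u hu => hz u hu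
  · rw [← hρ'T]
    have h0 : 0 ≤ ∫ s in (0 : ℝ)..T, ρ' s := intervalIntegral.integral_nonneg hT fun s _ => hρ'0 s
    change y' (τ _) = _
    rw [hz _ h0, ← htc T hT, hy'y T ⟨hT, le_rfl⟩]

theorem value_le_of_eq_integral_smul (h : P.Standing q₁ q₂ K₁ K₂)
    {α : ℝ → EuclideanSpace ℝ (Fin m)} {ρ : ℝ → ℝ} {T : ℝ} (hT : 0 ≤ T) (hα : P.IsControl α)
    (hρm : Measurable ρ) (hρ0 : ∀ t, 0 ≤ ρ t) (hρi : IntervalIntegrable ρ volume 0 T)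
    (hy : ContinuousOn y (Icc 0 T)) (hyc : ∀ t ∈ Icc 0 T, y t ∈ closure P.Ω)
    (heq : ∀ t ∈ Icc 0 T, y t = x + ∫ s in (0 : ℝ)..t, ρ s • P.f (y s) (α s)) :
    P.value x ≤ (K₂ + P.lam * q₂) * (∫ s in (0 : ℝ)..T, ρ s) + P.value (y T) := by
  obtain ⟨b, z, hbz, hzT⟩ :=
    h.exists_isAdmissible_of_eq_integral_smul hT hα hρm hρ0 hρi hy hyc heq
  rw [← hzT]
  exact h.value_le_add hbz (intervalIntegral.integral_nonneg hT fun s _ => hρ0 s)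

/-- Along an admissible trajectory the value drops by at most `K₂ + λ q₂` times the time spent
moving: the pauses can be left out. -/
theorem value_le_volume_ne_mul_add (h : P.Standing q₁ q₂ K₁ K₂) (hay : P.IsAdmissible x a y)
    {T : ℝ} (hT : 0 ≤ T) :
    P.value x ≤ (K₂ + P.lam * q₂) * (∫ s in (0 : ℝ)..T, {s | a s ≠ P.a₀}.indicator 1 s) +
      P.value (y T) := by
  have hM : MeasurableSet {s | a s ≠ P.a₀} :=
    (hay.isControl.1 (measurableSet_singleton P.a₀)).compl
  refine h.value_le_of_eq_integral_smul hT hay.isControl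
    (measurable_one.indicator hM) (fun t => indicator_nonneg (fun _ _ => zero_le_one) t) ?_
    (hay.continuousOn.mono Icc_subset_Ici_self) (fun t ht => hay.mem_closure t ht.1) ?_
  · exact (intervalIntegrable_const (c := (1 : ℝ))).mono_fun'
      (measurable_one.indicator hM).aestronglyMeasurable
      (ae_of_all _ fun s => by
        by_cases hs : a s = P.a₀ <;> simp [indicator, hs])
  · intro t ht
    rw [hay.eq_integral t ht.1]
    congr 1
    refine intervalIntegral.integral_congr fun s hs => ?_
    rw [uIcc_of_le ht.1] at hs
    by_cases hs' : a s = P.a₀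
    · simp [hs', h.free.1 _ (hay.mem_closure s hs.1)]
    · simp [indicator, hs']

/-- In a controllable system, the control that realizes a given direction at a given state can be
chosen measurably. -/
theorem exists_measurable_steering (h : P.Standing q₁ q₂ K₁ K₂) {F₁ F₂ : ℝ}
    (hc : P.Controllable F₁ F₂) :
    ∃ s : EuclideanSpace ℝ (Fin n) × EuclideanSpace ℝ (Fin n) → EuclideanSpace ℝ (Fin m),
      Measurable s ∧ (∀ p, s p ∈ P.A) ∧ ∀ x ∈ closure P.Ω, ∀ w, ‖w‖ = 1 →
        inner ℝ w (P.f x (s (x, w))) = ‖P.f x (s (x, w))‖ ∧ F₁ ≤ ‖P.f x (s (x, w))‖ := by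
  have : CompactSpace P.A := isCompact_iff_compactSpace.1 h.reg.isCompact_A
  set S : Set (EuclideanSpace ℝ (Fin n) × EuclideanSpace ℝ (Fin n)) :=
    closure P.Ω ×ˢ Metric.sphere 0 1 with hS
  have hScl : IsClosed S := isClosed_closure.prod Metric.isClosed_sphere
  have hpair : Continuous fun p : S × P.A => (p.1.1.1, p.2.1) := by fun_prop
  have hf : Continuous fun p : S × P.A => P.f p.1.1.1 p.2 :=
    h.continuousOn_f.comp_continuous hpair fun p => ⟨p.1.2.1, p.2.2⟩
  obtain ⟨s₀, hs₀m, hs₀⟩ := exists_measurable_selection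
    (C := {p : S × P.A | inner ℝ p.1.1.2 (P.f p.1.1.1 p.2) = ‖P.f p.1.1.1 p.2‖ ∧
      F₁ ≤ ‖P.f p.1.1.1 p.2‖})
    (by
      refine IsClosed.inter (isClosed_eq ?_ hf.norm) (isClosed_le continuous_const hf.norm)
      exact Continuous.inner (by fun_prop) hf)
    (fun p => by
      obtain ⟨a, ha, h1, h2⟩ := hc.2.2 p.1.1 p.2.1 p.1.2 (mem_sphere_zero_iff_norm.1 p.2.2)
      exact ⟨⟨a, ha⟩, h1, h2⟩)
  obtain ⟨s, hsm, hs⟩ :=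
    (MeasurableEmbedding.subtype_coe hScl.measurableSet).exists_measurable_extend hs₀m
      fun _ => ⟨⟨P.a₀, h.reg.a₀_mem⟩⟩
  refine ⟨fun p => s p, hsm.subtype_val, fun p => (s p).2, fun x hx w hw => ?_⟩
  have hmem : (x, w) ∈ S := ⟨hx, mem_sphere_zero_iff_norm.2 hw⟩
  have := hs₀ ⟨(x, w), hmem⟩
  rw [← hs] at this
  exact this

/-- In a controllable system the value drops along any path in the closed domain by at most
`(K₂ + λ q₂) / F₁` times the length of the path. -/
theorem value_le_of_path (h : P.Standing q₁ q₂ K₁ K₂) {F₁ F₂ : ℝ}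
    (hc : P.Controllable F₁ F₂) {p : ℝ → EuclideanSpace ℝ (Fin n)} {T : ℝ} (hT : 0 ≤ T)
    (hpm : Measurable p) (hpi : IntervalIntegrable p volume 0 T)
    (hy : ContinuousOn y (Icc 0 T)) (hyc : ∀ t ∈ Icc 0 T, y t ∈ closure P.Ω)
    (heq : ∀ t ∈ Icc 0 T, y t = x + ∫ s in (0 : ℝ)..t, p s) :
    P.value x ≤ (K₂ + P.lam * q₂) / F₁ * (∫ s in (0 : ℝ)..T, ‖p s‖) + P.value (y T) := by
  obtain ⟨s, hsm, hsA, hs⟩ := h.exists_measurable_steering hc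
  set y' : ℝ → EuclideanSpace ℝ (Fin n) := fun t => y (max 0 (min t T)) with hy'
  have hclamp : ∀ t, max 0 (min t T) ∈ Icc 0 T := fun t =>
    ⟨le_max_left _ _, max_le hT (min_le_right _ _)⟩
  have hy'c : Continuous y' := hy.comp_continuous (by fun_prop) hclamp
  have hy'm : ∀ t, y' t ∈ closure P.Ω := fun t => hyc _ (hclamp t)
  have hy'y : ∀ t ∈ Icc 0 T, y' t = y t := fun t ht => by
    simp [hy', min_eq_left ht.2, max_eq_right ht.1]
  set α : ℝ → EuclideanSpace ℝ (Fin m) := fun t => s (y' t, ‖p t‖⁻¹ • p t) with hα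
  have hαc : P.IsControl α :=
    ⟨hsm.comp (hy'c.measurable.prodMk (hpm.norm.inv.smul hpm)), fun t => hsA _⟩
  -- where `p = 0` the steering is meaningless, but there `ρ = 0`
  set ρ : ℝ → ℝ := fun t => ‖p t‖ / ‖P.f (y' t) (α t)‖ with hρ
  have hρm : Measurable ρ :=
    hpm.norm.div (h.measurable_f_comp hy'c.measurable hy'm hαc).norm
  have hρ0 : ∀ t, 0 ≤ ρ t := fun t => by positivity
  have hunit : ∀ t, p t ≠ 0 → ‖‖p t‖⁻¹ • p t‖ = 1 := fun t ht => norm_smul_inv_norm (𝕜 := ℝ) ht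
  have hρle : ∀ t, ρ t ≤ F₁⁻¹ * ‖p t‖ := fun t => by
    by_cases ht : p t = 0
    · simp [hρ, ht]
    · have := (hs _ (hy'm t) _ (hunit t ht)).2
      have hF := hc.1
      rw [hρ, inv_mul_eq_div]
      simp only
      gcongr
  have hρf : ∀ t, ρ t • P.f (y' t) (α t) = p t := fun t => by
    by_cases ht : p t = 0
    · simp [hρ, ht]
    · obtain ⟨h1, h2⟩ := hs _ (hy'm t) _ (hunit t ht)
      have hpos : 0 < ‖P.f (y' t) (α t)‖ := hc.1.trans_le h2
      have h3 := (inner_eq_norm_mul_iff_real (x := ‖p t‖⁻¹ • p t) (y := P.f (y' t) (α t))).1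
        (by rw [hunit t ht, one_mul]; exact h1)
      rw [hunit t ht, one_smul] at h3
      rw [← h3, smul_smul, smul_smul, hρ]
      simp only
      rw [div_mul_cancel₀ _ hpos.ne', mul_inv_cancel₀ (norm_ne_zero_iff.2 ht), one_smul]
  have hρi : IntervalIntegrable ρ volume 0 T :=
    (hpi.norm.const_mul F₁⁻¹).mono_fun' hρm.aestronglyMeasurable
      (ae_of_all _ fun t => (Real.norm_of_nonneg (hρ0 t)).trans_le (hρle t))
  refine (h.value_le_of_eq_integral_smul hT hαc hρm hρ0 hρi hy hyc fun t ht => ?_).trans ?_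
  · rw [heq t ht]
    congr 1
    refine intervalIntegral.integral_congr fun r hr => ?_
    rw [uIcc_of_le ht.1] at hr
    rw [← hy'y r ⟨hr.1, hr.2.trans ht.2⟩]
    exact (hρf r).symm
  · refine add_le_add ?_ le_rfl
    rw [div_mul_eq_mul_div, mul_div_assoc]
    refine mul_le_mul_of_nonneg_left ?_ h.rate_nonneg
    rw [div_eq_inv_mul, ← intervalIntegral.integral_const_mul]
    exact intervalIntegral.integral_mono_on hT hρi (hpi.norm.const_mul _) fun t _ => hρle t

end Standing

/-! ### Optimal controls -/

theorem measurableSet_ne_a₀ (ha : P.IsControl a) : MeasurableSet {t | a t ≠ P.a₀} :=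
  (ha.1 (measurableSet_singleton P.a₀)).compl

theorem intervalIntegrable_indicator_ne (ha : P.IsControl a) (s t : ℝ) :
    IntervalIntegrable ({r | a r ≠ P.a₀}.indicator (1 : ℝ → ℝ)) volume s t :=
  (intervalIntegrable_const (c := (1 : ℝ))).mono_fun'
    (measurable_one.indicator (measurableSet_ne_a₀ ha)).aestronglyMeasurable
    (ae_of_all _ fun r => by by_cases hr : a r = P.a₀ <;> simp [indicator, hr])

theorem intervalIntegral_indicator_ne (ha : P.IsControl a) {s t : ℝ} (hst : s ≤ t) :
    ∫ r in s..t, {r | a r ≠ P.a₀}.indicator (1 : ℝ → ℝ) r =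
      volume.real {r ∈ Icc s t | a r ≠ P.a₀} := by
  rw [intervalIntegral.integral_of_le hst, ← integral_Icc_eq_integral_Ioc,
    integral_indicator_one (measurableSet_ne_a₀ ha), Measure.real,
    Measure.restrict_apply (measurableSet_ne_a₀ ha), inter_comm]
  rfl

namespace Standing

/-- An admissible control can be stopped late at a small cost. -/
theorem exists_eventuallyMotionless (h : P.Standing q₁ q₂ K₁ K₂) (hx : x ∈ closure P.Ω) {ε : ℝ}
    (hε : 0 < ε) :
    ∃ a y, P.IsAdmissible x a y ∧ P.IsEventuallyMotionless a ∧ P.cost a y ≤ P.value x + ε := by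
  obtain ⟨_, ⟨a, y, hay, rfl⟩, hlt⟩ := exists_lt_of_csInf_lt
    (s := {c | ∃ a y, P.IsAdmissible x a y ∧ c = P.cost a y})
    ⟨_, _, _, h.isAdmissible_const hx, rfl⟩ (lt_add_of_pos_right (P.value x) (half_pos hε))
  have hlim : Filter.Tendsto (fun T => Real.exp (-P.lam * T) * q₂) Filter.atTop (nhds 0) := by
    have h1 := (Real.tendsto_exp_neg_atTop_nhds_zero.comp
      (Filter.tendsto_id.const_mul_atTop h.lam_pos)).mul_const q₂
    simpa [Function.comp_def] using h1
  obtain ⟨T, hTε, hT⟩ := ((hlim.eventually (gt_mem_nhds (half_pos hε))).and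
    (Filter.eventually_ge_atTop 0)).exists
  obtain ⟨hadm, hcost⟩ := h.isAdmissible_stopControl hay hT
  refine ⟨_, _, hadm, ⟨T, hT, fun t ht => if_neg (not_lt.2 ht)⟩, ?_⟩
  have h1 := h.cost_eq_integral_add hay hT
  have h2 := h.cost_nonneg (hay.shift hT)
  have h3 := h.terminal_le (hay.mem_closure T hT)
  have hE := Real.exp_pos (-P.lam * T)
  have h4 := mul_nonneg hE.le h2
  have h5 := mul_le_mul_of_nonneg_left h3 hE.le
  rw [hcost]
  linarith

/-- Bellman's principle: the tail of an optimal control is optimal. -/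
theorem value_eq_cost_shift (h : P.Standing q₁ q₂ K₁ K₂) (hopt : P.IsOptimal x a y) {T : ℝ}
    (hT : 0 ≤ T) :
    P.value (y T) = P.cost (fun t => a (t + T)) (fun t => y (t + T)) := by
  refine le_antisymm (h.value_le_cost (hopt.1.shift hT)) ?_
  have h1 := h.cost_eq_integral_add hopt.1 hT
  have h2 := h.value_le_integral_add hopt.1 hT
  rw [hopt.2] at h1
  exact le_of_mul_le_mul_left (by linarith) (Real.exp_pos (-P.lam * T))

theorem value_eq_integral_add (h : P.Standing q₁ q₂ K₁ K₂) (hopt : P.IsOptimal x a y) {T : ℝ}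
    (hT : 0 ≤ T) :
    P.value x = (∫ t in (0 : ℝ)..T, Real.exp (-P.lam * t) * P.effCost a y t) +
      Real.exp (-P.lam * T) * P.value (y T) := by
  rw [h.value_eq_cost_shift hopt hT, ← h.cost_eq_integral_add hopt.1 hT, hopt.2]

/-- Along an optimal trajectory, the value decreases at the rate `K + λ (q - v)`. -/
theorem value_sub_value (h : P.Standing q₁ q₂ K₁ K₂) (hopt : P.IsOptimal x a y) {s t : ℝ}
    (hs : 0 ≤ s) (hst : s ≤ t) :
    IntervalIntegrable (fun r => P.effCost a y r - P.lam * P.value (y r)) volume s t ∧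
      P.value (y s) - P.value (y t) =
        ∫ r in s..t, (P.effCost a y r - P.lam * P.value (y r)) := by
  have key : ∀ t, 0 ≤ t → IntervalIntegrable (fun r => P.value (y r)) volume 0 t ∧
      P.value (y t) =
        P.value x + ∫ r in (0 : ℝ)..t, (P.lam * P.value (y r) - P.effCost a y r) := fun t ht => by
    refine eq_add_integral_of_eq_exp_mul (W := fun r => P.value (y r))
      (h.intervalIntegrable_effCost hopt.1 le_rfl ht) ht fun r hr => ?_
    rw [h.value_eq_integral_add hopt hr, add_sub_cancel_left, ← mul_assoc, ← Real.exp_add]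
    simp
  have ht := hs.trans hst
  have hi : ∀ t, 0 ≤ t → IntervalIntegrable
      (fun r => P.lam * P.value (y r) - P.effCost a y r) volume 0 t := fun t ht =>
    ((key t ht).1.const_mul _).sub (h.intervalIntegrable_effCost hopt.1 le_rfl ht)
  have hneg : (fun r => P.effCost a y r - P.lam * P.value (y r)) =
      fun r => -(P.lam * P.value (y r) - P.effCost a y r) := by
    funext r; ring
  rw [hneg]
  refine ⟨((hi s hs).symm.trans (hi t ht)).neg, ?_⟩
  have hsub := intervalIntegral.integral_interval_sub_left (hi t ht) (hi s hs)
  rw [(key s hs).2, (key t ht).2, intervalIntegral.integral_neg, ← hsub]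
  ring

theorem movingCost_le_effCost_sub (h : P.Standing q₁ q₂ K₁ K₂) (hay : P.IsAdmissible x a y)
    {κ : ℝ} (hκ : (κ : EReal) ≤ P.movingCostInf) {r : ℝ} (hr : 0 ≤ r) :
    κ * {r | a r ≠ P.a₀}.indicator 1 r ≤ P.effCost a y r - P.lam * P.value (y r) := by
  have hm := hay.mem_closure r hr
  have h1 := mul_le_mul_of_nonneg_left (h.value_le_terminal hm) h.lam_pos.le
  have h2 : κ * {r | a r ≠ P.a₀}.indicator 1 r ≤ P.K (y r) (a r) := by
    by_cases hr' : a r = P.a₀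
    · simpa [hr'] using h.running_nonneg hm h.reg.a₀_mem
    · have h3 : P.movingCostInf ≤ (P.K (y r) (a r) : EReal) :=
        (iInf₂_le (y r) hm).trans (iInf₂_le (a r) ⟨hay.isControl.2 r, hr'⟩)
      simpa [indicator, hr'] using EReal.coe_le_coe_iff.1 (hκ.trans h3)
  unfold effCost
  linarith

theorem mul_volume_le_value_sub (h : P.Standing q₁ q₂ K₁ K₂) (hopt : P.IsOptimal x a y)
    {κ : ℝ} (hκ : (κ : EReal) ≤ P.movingCostInf) {s t : ℝ} (hs : 0 ≤ s) (hst : s ≤ t) :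
    κ * volume.real {r ∈ Icc s t | a r ≠ P.a₀} ≤ P.value (y s) - P.value (y t) := by
  obtain ⟨hi, he⟩ := h.value_sub_value hopt hs hst
  rw [he, ← intervalIntegral_indicator_ne hopt.1.isControl hst,
    ← intervalIntegral.integral_const_mul]
  exact intervalIntegral.integral_mono_on hst
    ((intervalIntegrable_indicator_ne hopt.1.isControl s t).const_mul κ) hi
    fun r hr => h.movingCost_le_effCost_sub hopt.1 hκ (hs.trans hr.1)

/-- Pausing is optimal only at motionless points. Between two times, an optimal trajectory
loses at least `∫ λ (q - v)` over its pauses, but leaving the pauses out shows that it loses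
value only while moving. -/
theorem ae_mem_motionlessSet_of_pause (h : P.Standing q₁ q₂ K₁ K₂) (hopt : P.IsOptimal x a y) :
    ∀ᵐ t, 0 < t → a t = P.a₀ → y t ∈ P.motionlessSet := by
  -- the integrand of the drop of the value, minus its bound by the time spent moving
  set g : ℝ → ℝ := fun r => (P.effCost a y r - P.lam * P.value (y r)) -
    (K₂ + P.lam * q₂) * {r | a r ≠ P.a₀}.indicator 1 r with hg
  have hind := fun s t => (intervalIntegrable_indicator_ne hopt.1.isControl s t).const_mul
    (K₂ + P.lam * q₂)
  have hgi : ∀ s t, 0 ≤ s → s ≤ t → ∫ r in s..t, g r ≤ 0 := by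
    intro s t hs hst
    obtain ⟨hi, he⟩ := h.value_sub_value hopt hs hst
    rw [hg, intervalIntegral.integral_sub hi (hind s t), ← he,
      intervalIntegral.integral_const_mul]
    have := h.value_le_volume_ne_mul_add (hopt.1.shift hs) (sub_nonneg.2 hst)
    have e := intervalIntegral.integral_comp_add_right (a := 0) (b := t - s)
      ({r | a r ≠ P.a₀}.indicator (1 : ℝ → ℝ)) s
    rw [zero_add, sub_add_cancel] at e
    rw [sub_add_cancel, show (∫ r in (0 : ℝ)..(t - s),
      {r | a (r + s) ≠ P.a₀}.indicator (1 : ℝ → ℝ) r) = _ from e] at this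
    linarith
  filter_upwards [ae_nonpos_of_forall_intervalIntegral_nonpos
    (fun t ht => (h.value_sub_value hopt le_rfl ht).1.sub (hind 0 t)) hgi] with t ht ht0 hat
  have hm := hopt.1.mem_closure t ht0.le
  have hgt := ht ht0
  simp only [effCost, hat, h.free.2 _ hm, zero_add, ne_eq, mem_ofPred_eq, not_true_eq_false,
    not_false_eq_true, indicator_of_notMem, mul_zero, sub_zero, ← mul_sub] at hgt
  exact h.mem_motionlessSet hm (sub_nonpos.1 (nonpos_of_mul_nonpos_right hgt h.lam_pos))

/-- Each unit of time spent moving costs a fixed amount of value, and only `q₂` is available. -/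
theorem volume_ne_lt_top (h : P.Standing q₁ q₂ K₁ K₂) (hopt : P.IsOptimal x a y)
    (hpos : 0 < P.movingCostInf) : volume {t : ℝ | 0 ≤ t ∧ a t ≠ P.a₀} < ⊤ := by
  obtain ⟨κ, hκ0, hκ⟩ := EReal.lt_iff_exists_real_btwn.1 hpos
  have hκ0 : 0 < κ := EReal.coe_pos.1 hκ0
  have hU : {t : ℝ | 0 ≤ t ∧ a t ≠ P.a₀} = ⋃ N : ℕ, {r ∈ Icc (0 : ℝ) N | a r ≠ P.a₀} := by
    ext t
    simp only [mem_ofPred_eq, mem_iUnion, mem_Icc]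
    constructor
    · rintro ⟨h1, h2⟩
      obtain ⟨N, hN⟩ := exists_nat_ge t
      exact ⟨N, ⟨h1, hN⟩, h2⟩
    · rintro ⟨N, ⟨h1, -⟩, h2⟩
      exact ⟨h1, h2⟩
  have hmono : Monotone fun N : ℕ => {r ∈ Icc (0 : ℝ) N | a r ≠ P.a₀} := fun M N hMN r hr =>
    ⟨⟨hr.1.1, hr.1.2.trans (Nat.cast_le.2 hMN)⟩, hr.2⟩
  rw [hU, hmono.measure_iUnion]
  refine (iSup_le fun N => ?_).trans_lt (ENNReal.ofReal_lt_top (r := q₂ / κ))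
  have hfin : volume {r ∈ Icc (0 : ℝ) N | a r ≠ P.a₀} ≠ ⊤ :=
    ((measure_mono (sep_subset _ _)).trans_lt measure_Icc_lt_top).ne
  rw [← ENNReal.ofReal_toReal hfin]
  refine ENNReal.ofReal_le_ofReal ((le_div_iff₀' hκ0).2 ?_)
  have h1 := h.mul_volume_le_value_sub hopt hκ.le le_rfl N.cast_nonneg
  have hm0 := hopt.1.mem_closure 0 le_rfl
  have h2 := h.value_mem_Icc (hopt.1.mem_closure N N.cast_nonneg)
  have h3 := h.value_mem_Icc hm0
  have h4 := h.terminal_le hm0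
  have h5 := h.terminal.2.1
  exact h1.trans (by linarith [h2.1, h3.2])

theorem exists_eventuallyMotionless_ae_eq (h : P.Standing q₁ q₂ K₁ K₂)
    (hopt : P.IsOptimal x a y) (hpos : 0 < P.movingCostInf) (hres : P.NeverResumes a) :
    ∃ b, P.IsControl b ∧ P.IsEventuallyMotionless b ∧ b =ᵐ[volume.restrict (Ici 0)] a := by
  have hfin := h.volume_ne_lt_top hopt hpos
  obtain ⟨N, hN⟩ := ENNReal.exists_nat_gt hfin.ne
  have hpause : 0 < volume {s ∈ Icc (0 : ℝ) N | a s = P.a₀} := by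
    refine pos_iff_ne_zero.2 fun h0 => hN.not_ge ?_
    have hsub : Icc (0 : ℝ) N ⊆ {t : ℝ | 0 ≤ t ∧ a t ≠ P.a₀} ∪ {s ∈ Icc (0 : ℝ) N | a s = P.a₀} :=
      fun t ht => by
        by_cases hat : a t = P.a₀
        · exact Or.inr ⟨ht, hat⟩
        · exact Or.inl ⟨ht.1, hat⟩
    have := (measure_mono hsub).trans (measure_union_le (μ := volume) _ _)
    rw [h0, add_zero, Real.volume_Icc, sub_zero, ENNReal.ofReal_natCast] at this
    exact this
  refine ⟨P.stopControl a N, (h.isAdmissible_stopControl hopt.1 N.cast_nonneg).1.isControl,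
    ⟨N, N.cast_nonneg, fun t ht => if_neg (not_lt.2 ht)⟩, ?_⟩
  filter_upwards [ae_restrict_of_ae (hres N hpause)] with t ht
  by_cases htN : t < N
  · exact if_pos htN
  · exact (if_neg htN).trans (ht (not_lt.1 htN)).symm

/-- Pauses occur arbitrarily late, and almost all of them are at motionless points. -/
theorem exists_isOptimal_stopControl (h : P.Standing q₁ q₂ K₁ K₂) (hopt : P.IsOptimal x a y)
    (hpos : 0 < P.movingCostInf) {T₀ : ℝ} (hT₀ : 0 ≤ T₀) :
    ∃ T, T₀ ≤ T ∧ y T ∈ P.motionlessSet ∧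
      P.IsOptimal x (P.stopControl a T) (fun t => y (min t T)) := by
  obtain ⟨T, hT, hTm⟩ : ∃ T, T₀ < T ∧ y T ∈ P.motionlessSet := by
    by_contra! hcon
    -- otherwise the control would move at almost all times after `T₀`
    have hle : volume (Ioi T₀) ≤ volume {t : ℝ | 0 ≤ t ∧ a t ≠ P.a₀} := by
      refine measure_mono_ae ?_
      filter_upwards [h.ae_mem_motionlessSet_of_pause hopt] with t ht htT
      have ht0 : 0 < t := hT₀.trans_lt htT
      exact ⟨ht0.le, fun hat => hcon t htT (ht ht0 hat)⟩
    rw [Real.volume_Ioi] at hle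
    exact (h.volume_ne_lt_top hopt hpos).not_ge hle
  have hT0 := hT₀.trans hT.le
  obtain ⟨hadm, hcost⟩ := h.isAdmissible_stopControl hopt.1 hT0
  refine ⟨T, hT.le, hTm, hadm, ?_⟩
  rw [hcost, ← hTm.2.2, ← h.value_eq_integral_add hopt hT0]

theorem antitoneOn_value (h : P.Standing q₁ q₂ K₁ K₂) (hKbar : 0 ≤ P.movingCostInf)
    (hopt : P.IsOptimal x a y) : AntitoneOn (fun t => P.value (y t)) (Ici 0) := by
  intro s hs t _ hst
  have := h.mul_volume_le_value_sub hopt (κ := 0) (by simpa using hKbar) hs hst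
  rw [zero_mul] at this
  exact sub_nonneg.1 this

theorem value_lt_value (h : P.Standing q₁ q₂ K₁ K₂) (hpos : 0 < P.movingCostInf)
    (hopt : P.IsOptimal x a y) {s t : ℝ} (hs : 0 ≤ s) (hst : s < t)
    (hmove : 0 < volume {r ∈ Icc s t | a r ≠ P.a₀}) : P.value (y t) < P.value (y s) := by
  obtain ⟨κ, hκ0, hκ⟩ := EReal.lt_iff_exists_real_btwn.1 hpos
  have hfin : volume {r ∈ Icc s t | a r ≠ P.a₀} ≠ ⊤ :=
    ((measure_mono (sep_subset _ _)).trans_lt measure_Icc_lt_top).ne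
  have h1 := mul_pos (EReal.coe_pos.1 hκ0) (ENNReal.toReal_pos hmove.ne' hfin)
  exact sub_pos.1 (h1.trans_le (h.mul_volume_le_value_sub hopt hκ.le hs hst.le))

theorem value_le_of_segment (h : P.Standing q₁ q₂ K₁ K₂) {F₁ F₂ : ℝ} (hc : P.Controllable F₁ F₂)
    {x' : EuclideanSpace ℝ (Fin n)} (hseg : segment ℝ x x' ⊆ closure P.Ω) :
    P.value x ≤ (K₂ + P.lam * q₂) / F₁ * ‖x' - x‖ + P.value x' := by
  have := h.value_le_of_path hc (x := x) (y := fun t => x + t • (x' - x))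
    (p := fun _ => x' - x) zero_le_one measurable_const intervalIntegrable_const
    (by fun_prop) (fun t ht => hseg ?_) fun t _ => by simp [smul_sub]
  · simpa using this
  · rw [segment_eq_image']
    exact ⟨t, ht, rfl⟩

theorem volume_mul_le_norm_sub (h : P.Standing q₁ q₂ K₁ K₂) {F₁ F₂ : ℝ}
    (hc : P.Controllable F₁ F₂) (hpos : 0 < P.movingCostInf) (hopt : P.IsOptimal x a y) {t : ℝ}
    (ht : 0 ≤ t) (hseg : segment ℝ x (y t) ⊆ closure P.Ω) :
    volume.real {s ∈ Icc 0 t | a s ≠ P.a₀} *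
      (P.movingCostInf.toReal * F₁ / (K₂ + P.lam * q₂)) ≤ ‖y t - x‖ := by
  rcases eq_or_ne P.movingCostInf ⊤ with htop | htop
  · simp [htop]
  have hκ := (EReal.coe_toReal htop (bot_le.trans_lt hpos).ne').le
  rcases h.rate_nonneg.eq_or_lt with hC | hC
  · simp [← hC]
  have h1 := h.mul_volume_le_value_sub hopt hκ le_rfl ht
  have h2 := h.value_le_of_segment hc hseg
  rw [hopt.1.apply_zero] at h1
  have h3 := h1.trans (sub_le_iff_le_add.2 h2)
  rw [div_mul_eq_mul_div, le_div_iff₀ hc.1] at h3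
  rw [← mul_div_assoc, div_le_iff₀ hC]
  linarith

/-- An admissible trajectory may be slow, or pause. Retracing it at speed at least `F₁` bounds the
drop of the value by its length instead of its duration. -/
theorem value_le_add_eVariationOn (h : P.Standing q₁ q₂ K₁ K₂) {F₁ F₂ : ℝ}
    (hc : P.Controllable F₁ F₂) (hay : P.IsAdmissible x a y) {T : ℝ} (hT : 0 ≤ T) :
    ENNReal.ofReal (P.value x) ≤ ENNReal.ofReal (P.value (y T)) +
      eVariationOn y (Icc 0 T) * ENNReal.ofReal ((K₂ + P.lam * q₂) / F₁) := by
  -- nothing is known about `y` at negative times, so the velocity is extended through `y 0`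
  set p : ℝ → EuclideanSpace ℝ (Fin n) := fun t => P.f (y (max t 0)) (a t) with hp
  have hpf : ∀ t, 0 ≤ t → EqOn (fun s => P.f (y s) (a s)) p (uIcc 0 t) := fun t ht s hs => by
    rw [uIcc_of_le ht] at hs
    simp [hp, max_eq_left hs.1]
  have hpi : IntervalIntegrable p volume 0 T :=
    (hay.intervalIntegrable T hT).congr fun s hs => hpf T hT (uIoc_subset_uIcc hs)
  have heq : ∀ t ∈ Icc 0 T, y t = x + ∫ s in (0 : ℝ)..t, p s := fun t ht => by
    rw [hay.eq_integral t ht.1, intervalIntegral.integral_congr (hpf t ht.1)]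
  have hv := h.value_le_of_path hc hT
    (h.measurable_f_comp hay.continuous_comp_max.measurable hay.comp_max_mem hay.isControl) hpi
    (hay.continuousOn.mono Icc_subset_Ici_self) (fun t ht => hay.mem_closure t ht.1) heq
  have hlen := ofReal_integral_norm_le_eVariationOn hT hpi heq
  have hL : 0 ≤ (K₂ + P.lam * q₂) / F₁ := div_nonneg h.rate_nonneg hc.1.le
  refine (ENNReal.ofReal_le_ofReal hv).trans (ENNReal.ofReal_add_le.trans ?_)
  rw [add_comm, ENNReal.ofReal_mul hL, mul_comm (ENNReal.ofReal _)]
  gcongr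

theorem value_le_add_pathDiam (h : P.Standing q₁ q₂ K₁ K₂) {F₁ F₂ : ℝ}
    (hc : P.Controllable F₁ F₂) (hx : x ∈ closure P.Ω) :
    ENNReal.ofReal (P.value x) ≤
      ENNReal.ofReal q₁ + P.pathDiam * ENNReal.ofReal ((K₂ + P.lam * q₂) / F₁) := by
  rcases h.rate_nonneg.eq_or_lt with hC | hC
  · -- both costs vanish, and so does the value
    have h1 : P.lam * q₂ = 0 := by
      linarith [h.K₂_nonneg, mul_nonneg h.lam_pos.le h.q₂_nonneg]
    have h2 : q₂ = 0 := (mul_eq_zero.1 h1).resolve_left h.lam_pos.ne'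
    rw [ENNReal.ofReal_of_nonpos ((h.value_le_terminal hx).trans ((h.terminal_le hx).trans h2.le))]
    exact bot_le
  obtain ⟨x₂, hx₂, hq₂⟩ := h.terminal.1.1
  have hL : ENNReal.ofReal ((K₂ + P.lam * q₂) / F₁) ≠ 0 :=
    (ENNReal.ofReal_pos.2 (div_pos hC hc.1)).ne'
  have hdist : (ENNReal.ofReal (P.value x) - ENNReal.ofReal q₁) /
      ENNReal.ofReal ((K₂ + P.lam * q₂) / F₁) ≤ P.pathDist x x₂ := by
    refine le_sInf ?_
    rintro _ ⟨a, y, hay, T, hT, hyT, rfl⟩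
    rw [ENNReal.div_le_iff hL ENNReal.ofReal_ne_top, tsub_le_iff_left]
    refine (h.value_le_add_eVariationOn hc hay hT).trans ?_
    rw [hyT, ← hq₂]
    gcongr
    exact h.value_le_terminal hx₂
  have hdiam : P.pathDist x x₂ ≤ P.pathDiam :=
    (le_iSup₂ (f := fun x₂ (_ : x₂ ∈ closure P.Ω) => P.pathDist x x₂) x₂ hx₂).trans
      (le_iSup₂ (f := fun x₁ (_ : x₁ ∈ closure P.Ω) => ⨆ x₂ ∈ closure P.Ω, P.pathDist x₁ x₂) x hx)
  rw [← tsub_le_iff_left, ← ENNReal.div_le_iff hL ENNReal.ofReal_ne_top]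
  exact hdist.trans hdiam

end Standing
end StoppingProblem

theorem mainTheorem4 {n m : ℕ} (P : StoppingProblem n m) (q₁ q₂ K₁ K₂ : ℝ)
    (hreg : P.Regular) (hq : P.TerminalCostBounds q₁ q₂) (hK : P.RunningCostBounds K₁ K₂)
    (hfree : P.FreeMotionless) (hKbar : 0 ≤ P.movingCostInf) :
    -- Part 1: bounds
    (∀ x ∈ P.Ω, P.value x ∈ Set.Icc q₁ (P.q x)) ∧
    -- Part 2: minimizers of the terminal cost are motionless
    (∀ x ∈ P.Ω, P.q x = q₁ → x ∈ P.motionlessSet) ∧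
    -- Part 3: suboptimal eventually motionless controls
    (∀ x ∈ P.Ω, ∀ ε : ℝ, 0 < ε →
      ∃ a y, P.IsAdmissible x a y ∧ P.IsEventuallyMotionless a ∧ P.cost a y ≤ P.value x + ε) ∧
    -- Part 4: optimal controls are eventually motionless
    (0 < P.movingCostInf → ∀ x ∈ P.Ω, ∀ a y, P.IsOptimal x a y →
      (P.NeverResumes a → ∃ b, P.IsControl b ∧ P.IsEventuallyMotionless b ∧
        b =ᵐ[MeasureTheory.volume.restrict (Set.Ici 0)] a) ∧
      MeasureTheory.volume {t : ℝ | 0 ≤ t ∧ a t ≠ P.a₀} < ⊤ ∧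
      (∀ T₀ : ℝ, 0 ≤ T₀ → ∃ T : ℝ, T₀ ≤ T ∧ y T ∈ P.motionlessSet ∧
        P.IsOptimal x (P.stopControl a T) (fun t => y (min t T)))) ∧
    -- Part 5: monotonicity of the value along optimal trajectories
    (∀ x ∈ P.Ω, ∀ a y, P.IsOptimal x a y →
      AntitoneOn (fun t => P.value (y t)) (Set.Ici 0) ∧
      (0 < P.movingCostInf → ∀ s t : ℝ, 0 ≤ s → s < t →
        0 < MeasureTheory.volume {r ∈ Set.Icc s t | a r ≠ P.a₀} →
        P.value (y t) < P.value (y s))) ∧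
    -- Part 6: linear growth of the distance in the time spent moving
    (∀ F₁ F₂ : ℝ, P.Controllable F₁ F₂ → 0 < P.movingCostInf →
      ∀ x ∈ P.Ω, ∀ a y, P.IsOptimal x a y → ∀ t : ℝ, 0 ≤ t →
        segment ℝ x (y t) ⊆ closure P.Ω →
        MeasureTheory.volume.real {s ∈ Set.Icc 0 t | a s ≠ P.a₀} *
          (P.movingCostInf.toReal * F₁ / (K₂ + P.lam * q₂)) ≤ ‖y t - x‖) ∧
    -- Part 7: upper bound through the diameter of the domain
    (∀ F₁ F₂ : ℝ, P.Controllable F₁ F₂ → ∀ x ∈ P.Ω,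
      ENNReal.ofReal (P.value x) ≤
        ENNReal.ofReal q₁ + P.pathDiam * ENNReal.ofReal ((K₂ + P.lam * q₂) / F₁)) := by
  have h : P.Standing q₁ q₂ K₁ K₂ := ⟨hreg, hq, hK, hfree⟩
  refine ⟨fun x hx => h.value_mem_Icc (subset_closure hx), fun x hx hqx => ?_,
    fun x hx ε hε => h.exists_eventuallyMotionless (subset_closure hx) hε,
    fun hpos x _ a y hopt => ⟨h.exists_eventuallyMotionless_ae_eq hopt hpos,
      h.volume_ne_lt_top hopt hpos, fun T₀ hT₀ => h.exists_isOptimal_stopControl hopt hpos hT₀⟩,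
    fun x _ a y hopt => ⟨h.antitoneOn_value hKbar hopt,
      fun hpos s t hs hst hmove => h.value_lt_value hpos hopt hs hst hmove⟩,
    fun F₁ F₂ hc hpos x _ a y hopt t ht hseg => h.volume_mul_le_norm_sub hc hpos hopt ht hseg,
    fun F₁ F₂ hc x hx => h.value_le_add_pathDiam hc (subset_closure hx)⟩
  have hx' := subset_closure hx
  exact h.mem_motionlessSet hx' (hqx.trans_le (h.value_mem_Icc hx').1)
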